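/- Let $k$ be a field of characteristic zero and let $H$ be a Hopf algebra over $k$ with comultiplication $\Delta(h)=h_1\otimes h_2$, counit $\varepsilon$ and bijective antipode $S$. A left $H$-category is a small $k$-linear category $\mathcal D_H$ whose morphism spaces are left $H$-modules (with the given $k$-structure) such that $h(\mathrm{id}_X)=\varepsilon(h)\,\mathrm{id}_X$ and $h(g\circ f)=(h_1g)\circ(h_2f)$. An $H$-linear semifunctor between left $H$-categories is an assignment on objects and morphisms that is $k$-linear and $H$-linear on morphisms and preserves composition (but not necessarily identities). A right-left stable anti-Yetter--Drinfeld (SAYD) module over $H$ is a $k$-vector space $M$ that is a right $H$-module and a left $H$-comodule, $m\mapsto m_{(-1)}\otimes m_{(0)}$, such that $(mh)_{(-1)}\otimes (mh)_{(0)}=S(h_3)m_{(-1)}h_1\otimes m_{(0)}h_2$ and $m_{(0)}m_{(-1)}=m$ for all $m\in M$, $h\in H$. Put $CN_n(\mathcal D_H)=\bigoplus_{(X_0,\dots,X_n)}\mathrm{Hom}(X_1,X_0)\otimes \mathrm{Hom}(X_2,X_1)\otimes\cdots\otimes \mathrm{Hom}(X_0,X_n)$ with the diagonal left $H$-action, and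 let $C^n_H(\mathcal D_H,M)$ be the space of $k$-linear maps $\phi:M\otimes CN_n(\mathcal D_H)\to k$ with $\phi(mh_1\otimes S(h_2)c)=\varepsilon(h)\phi(m\otimes c)$ for all $m\in M$, $c\in CN_n(\mathcal D_H)$, $h\in H$. Let $$(\tau_n\phi)(m\otimes f^0\otimes\cdots\otimes f^n)=\phi\big(m_{(0)}\otimes S^{-1}(m_{(-1)})f^n\otimes f^0\otimes\cdots\otimes f^{n-1}\big),$$ $$(b\phi)(m\otimes f^0\otimes\cdots\otimes f^{n+1})=\sum_{i=0}^{n}(-1)^i\phi(m\otimes f^0\otimes\cdots\otimes f^if^{i+1}\otimes\cdots\otimes f^{n+1})+(-1)^{n+1}\phi\big(m_{(0)}\otimes (S^{-1}(m_{(-1)})f^{n+1})f^0\otimes f^1\otimes\cdots\otimes f^n\big).$$ The Hopf-cyclic cohomology $HC^\bullet_H(\mathcal D_H,M)$ is the cohomology of the complex with terms $C^n_\lambda=\{\phi\in C^n_H(\mathcal D_H,M): (-1)^n\tau_n\phi=\phi\}$, $n\ge 0$, and differential $b$. Let $\mathcal D_H\otimes M_2(k)$ be the left $H$-category with the same objects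 as $\mathcal D_H$, with morphism spaces $\mathrm{Hom}_{\mathcal D_H}(X,Y)\otimes M_2(k)$, composition $(g\otimes C)\circ(f\otimes B)=gf\otimes CB$ and action $h(f\otimes B)=hf\otimes B$. For a left $H$-category $\mathcal C$ let $\mathbb U_H(\mathcal C)$ be the set of families $\eta=\{\eta(X)\in \mathrm{Aut}_{\mathcal C}(X)\}_{X\in Ob(\mathcal C)}$ with $h(\eta(X))=\varepsilon(h)\eta(X)$ for all $h\in H$ and all objects $X$, and for $\eta\in\mathbb U_H(\mathcal C)$ and $u:X\to Y$ in $\mathcal C$ put $\Phi_\eta(u)=\eta(Y)\circ u\circ\eta(X)^{-1}$. **Proposition 5.5.** Let $\mathcal D_H$ be a left $H$-category. Suppose that there are an $H$-linear semifunctor $\upsilon:\mathcal D_H\to\mathcal D_H$ and an $\eta\in\mathbb U_H(\mathcal D_H\otimes M_2(k))$ such that 1. $\upsilon(X)=X$ for every object $X$ of $\mathcal D_H$; 2. $\Phi_\eta(f\otimes E_{11}+\upsilon(f)\otimes E_{22})=\upsilon(f)\otimes E_{22}$ for all objects $X,Y$ and all $f\in \mathrm{Hom}_{\mathcal D_H}(X,Y)$.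 Then $HC^n_H(\mathcal D_H,M)=0$ for every right-left SAYD module $M$ over $H$ and every $n\ge 0$. -/

import Mathlib

open CategoryTheory TensorProduct

noncomputable section

namespace HopfCyclic

universe uk uH uD vD uM uA

/-! ## Hopf algebras with bijective antipode -/

/-- The antipode of the Hopf algebra `H` is bijective. -/
class BijectiveAntipode (k : Type uk) (H : Type uH) [Field k] [Ring H] [HopfAlgebra k H] :
    Prop where
  bijective : Function.Bijective (HopfAlgebra.antipode k (A := H))

/-- The inverse `S⁻¹` of the antipode. -/
def antipodeInv (k : Type uk) (H : Type uH) [Field k] [Ring H] [HopfAlgebra k H]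
    [BijectiveAntipode k H] : H →ₗ[k] H :=
  (LinearEquiv.ofBijective (HopfAlgebra.antipode k (A := H))
    BijectiveAntipode.bijective).symm.toLinearMap

/-- `h ⊗ t ↦ h ⊗ t`, as a bilinear map `H × H^{⊗(n+1)} → H^{⊗(n+2)}`. -/
def consTensor (k : Type uk) (H : Type uH) [Field k] [Ring H] [HopfAlgebra k H] (n : ℕ) :
    H →ₗ[k] (⨂[k] _ : Fin (n + 1), H) →ₗ[k] (⨂[k] _ : Fin (n + 2), H) :=
  (PiTensorProduct.lift (R := k) (s := fun _ : Fin (n + 1) => H)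
      (E := ⨂[k] _ : Fin (n + 2), H)).toLinearMap ∘ₗ
    (PiTensorProduct.tprod k (s := fun _ : Fin (n + 2) => H)).curryLeft

/-- The iterated coproduct `H → H^{⊗(n+1)}`, `h ↦ h₁ ⊗ h₂ ⊗ ⋯ ⊗ h_{n+1}`. -/
def iterComul (k : Type uk) (H : Type uH) [Field k] [Ring H] [HopfAlgebra k H] :
    (n : ℕ) → (H →ₗ[k] ⨂[k] _ : Fin (n + 1), H)
  | 0 => (PiTensorProduct.subsingletonEquiv (R := k) (s := fun _ : Fin 1 => H) (0 : Fin 1)).symm.toLinearMap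
  | n + 1 =>
      TensorProduct.lift ((consTensor k H n).compl₂ (iterComul k H n)) ∘ₗ Coalgebra.comul

/-! ## Hopf-module categories -/

/-- The morphism spaces of the `k`-linear category `D` are left `H`-modules; the underlying
`k`-vector space structure is the given one. -/
class HModuleHoms (k : Type uk) (H : Type uH) (D : Type uD) [Field k] [Ring H] [HopfAlgebra k H]
    [Category.{vD} D] [Preadditive D] [Linear k D] where
  homModule : ∀ X Y : D, Module H (X ⟶ Y)
  isScalarTower : ∀ X Y : D, IsScalarTower k H (X ⟶ Y)

attribute [reducible, instance] HModuleHoms.homModule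
attribute [instance] HModuleHoms.isScalarTower

/-- A left `H`-category: a (small) `k`-linear category whose morphism spaces are left `H`-modules
with `h(id_X) = ε(h) id_X` and `h(g ∘ f) = (h₁ g) ∘ (h₂ f)`. The Sweedler sum is written out for an
arbitrary expression `Δ(h) = ∑ aᵢ ⊗ bᵢ`. Note that Mathlib's `f ≫ g` is `g ∘ f`. -/
class HCategory (k : Type uk) (H : Type uH) (D : Type uD) [Field k] [Ring H] [HopfAlgebra k H]
    [Category.{vD} D] [Preadditive D] [Linear k D] extends HModuleHoms k H D where
  smul_id : ∀ (h : H) (X : D), h • 𝟙 X = Coalgebra.counit (R := k) h • 𝟙 X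
  smul_comp : ∀ {X Y Z : D} (h : H) (f : X ⟶ Y) (g : Y ⟶ Z) (r : ℕ) (a b : Fin r → H),
    Coalgebra.comul (R := k) h = ∑ i, a i ⊗ₜ[k] b i →
      h • (f ≫ g) = ∑ i, (b i • f) ≫ (a i • g)

/-- An `H`-linear semifunctor between left `H`-categories: it preserves composition and is linear
over `k` and `H` on morphisms, but need not preserve identities. -/
structure HSemifunctor (k : Type uk) (H : Type uH) (D : Type uD) (D' : Type uD)
    [Field k] [Ring H] [HopfAlgebra k H]
    [Category.{vD} D] [Preadditive D] [Linear k D] [HCategory k H D]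
    [Category.{vD} D'] [Preadditive D'] [Linear k D'] [HCategory k H D'] where
  obj : D → D'
  map : ∀ {X Y : D}, (X ⟶ Y) →ₗ[k] (obj X ⟶ obj Y)
  map_comp : ∀ {X Y Z : D} (f : X ⟶ Y) (g : Y ⟶ Z), map (f ≫ g) = map f ≫ map g
  map_hsmul : ∀ {X Y : D} (h : H) (f : X ⟶ Y), map (h • f) = h • map f

/-- For a semifunctor that fixes all objects, its value on `f : X ⟶ Y` as a morphism `X ⟶ Y`. -/
def HSemifunctor.mapFix {k : Type uk} {H : Type uH} {D : Type uD}
    [Field k] [Ring H] [HopfAlgebra k H]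
    [Category.{vD} D] [Preadditive D] [Linear k D] [HCategory k H D]
    (υ : HSemifunctor k H D D) (hυ : ∀ X, υ.obj X = X) {X Y : D} (f : X ⟶ Y) : X ⟶ Y :=
  eqToHom (hυ X).symm ≫ υ.map f ≫ eqToHom (hυ Y)

/-- The set `𝕌_H(D)` of families `η = {η(X) ∈ Aut(X)}` with `h(η(X)) = ε(h) η(X)`. -/
def invariantAut (k : Type uk) (H : Type uH) (D : Type uD) [Field k] [Ring H] [HopfAlgebra k H]
    [Category.{vD} D] [Preadditive D] [Linear k D] [HCategory k H D] : Set (∀ X : D, Aut X) :=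
  {η | ∀ (h : H) (X : D), h • (η X).hom = Coalgebra.counit (R := k) h • (η X).hom}

/-- The inner automorphism `Φ_η`: the identity on objects, and
`Φ_η(f) = η(Y) ∘ f ∘ η(X)⁻¹` for `f : X ⟶ Y`. -/
def innerAut {D : Type uD} [Category.{vD} D] (η : ∀ X : D, Aut X) : D ⥤ D where
  obj X := X
  map {X Y} f := (η X).inv ≫ f ≫ (η Y).hom
  map_id X := by rw [Category.id_comp]; exact Iso.inv_hom_id (η X)
  map_comp {X Y Z} f g := by
    have h := Iso.hom_inv_id_assoc (η Y) (g ≫ (η Z).hom)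
    simp only [Category.assoc, h]

/-! ## The category `D ⊗ A` for a `k`-algebra `A` -/

/-- Objects of `D ⊗ A`: those of `D`. -/
structure TensorCat (k : Type uk) (D : Type uD) (A : Type uA) where
  base : D

section TensorCat

variable {k : Type uk} {H : Type uH} {D : Type uD} {A : Type uA}
  [Field k] [Ring H] [HopfAlgebra k H] [Ring A] [Algebra k A]
  [Category.{vD} D] [Preadditive D] [Linear k D]

/-- Morphisms of `D ⊗ A` are `Hom_D(X, Y) ⊗ A`, and `(g ⊗ b) ∘ (f ⊗ a) = (g ∘ f) ⊗ (b a)`. -/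
def TensorCat.compL (X Y Z : D) :
    ((X ⟶ Y) ⊗[k] A) →ₗ[k] ((Y ⟶ Z) ⊗[k] A) →ₗ[k] ((X ⟶ Z) ⊗[k] A) :=
  TensorProduct.map₂ (Linear.comp X Y Z) (LinearMap.mul k A).flip

@[simp] theorem TensorCat.compL_tmul {X Y Z : D} (f : X ⟶ Y) (g : Y ⟶ Z) (a b : A) :
    TensorCat.compL X Y Z (f ⊗ₜ[k] a) (g ⊗ₜ[k] b) = (f ≫ g) ⊗ₜ[k] (b * a) := by
  simp [TensorCat.compL]

instance : Category.{max vD uA} (TensorCat k D A) where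
  Hom X Y := (X.base ⟶ Y.base) ⊗[k] A
  id X := 𝟙 X.base ⊗ₜ[k] (1 : A)
  comp {X Y Z} u v := TensorCat.compL X.base Y.base Z.base u v
  id_comp {X Y} u := by
    induction u using TensorProduct.induction_on with
    | zero => simp
    | tmul f a => simp
    | add x y hx hy => simp [map_add, hx, hy]
  comp_id {X Y} u := by
    induction u using TensorProduct.induction_on with
    | zero => simp
    | tmul f a => simp
    | add x y hx hy => simp [map_add, hx, hy]
  assoc {W X Y Z} u v w := by
    induction u using TensorProduct.induction_on with
    | zero => simp
    | add x y hx hy => simp only [map_add, LinearMap.add_apply, hx, hy]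
    | tmul f a =>
      induction v using TensorProduct.induction_on with
      | zero => simp
      | add x y hx hy => simp only [map_add, LinearMap.add_apply, hx, hy]
      | tmul g b =>
        induction w using TensorProduct.induction_on with
        | zero => simp
        | add x y hx hy => simp only [map_add, hx, hy]
        | tmul l c => simp [mul_assoc]

/-- The morphism `f ⊗ a` of `D ⊗ A`. -/
def TensorCat.tmul {X Y : D} (f : X ⟶ Y) (a : A) :
    (TensorCat.mk X : TensorCat k D A) ⟶ TensorCat.mk Y :=
  f ⊗ₜ[k] a

instance : Preadditive (TensorCat k D A) where
  homGroup X Y := inferInstanceAs (AddCommGroup ((X.base ⟶ Y.base) ⊗[k] A))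
  add_comp X Y Z u u' v := by
    exact LinearMap.map_add₂ (TensorCat.compL (k := k) (A := A) X.base Y.base Z.base) u u' v
  comp_add X Y Z u v v' := by
    exact (TensorCat.compL (k := k) (A := A) X.base Y.base Z.base u).map_add v v'

instance : Linear k (TensorCat k D A) where
  homModule X Y := inferInstanceAs (Module k ((X.base ⟶ Y.base) ⊗[k] A))
  smul_comp X Y Z r u v := by
    exact LinearMap.map_smul₂ (TensorCat.compL (k := k) (A := A) X.base Y.base Z.base) r u v
  comp_smul X Y Z u r v := by
    exact (TensorCat.compL (k := k) (A := A) X.base Y.base Z.base u).map_smul r v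

end TensorCat

section TensorCatH

variable {k : Type uk} {H : Type uH} {D : Type uD} {A : Type uA}
  [Field k] [Ring H] [HopfAlgebra k H] [Ring A] [Algebra k A]
  [Category.{vD} D] [Preadditive D] [Linear k D] [HModuleHoms k H D]

instance (X Y : D) : SMulCommClass k H (X ⟶ Y) := IsScalarTower.to_smulCommClass

/-- `H` acts on `Hom_D(X, Y) ⊗ A` by `h(f ⊗ a) = hf ⊗ a`. -/
instance : HModuleHoms k H (TensorCat k D A) where
  homModule X Y := inferInstanceAs (Module H ((X.base ⟶ Y.base) ⊗[k] A))
  isScalarTower X Y := inferInstanceAs (IsScalarTower k H ((X.base ⟶ Y.base) ⊗[k] A))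

end TensorCatH

/-- `D ⊗ A` is a left `H`-category. -/
instance {k : Type uk} {H : Type uH} {D : Type uD} {A : Type uA}
    [Field k] [Ring H] [HopfAlgebra k H] [Ring A] [Algebra k A]
    [Category.{vD} D] [Preadditive D] [Linear k D] [HCategory k H D] :
    HCategory k H (TensorCat k D A) where
  smul_id h X := by
    change h • (𝟙 X.base ⊗ₜ[k] (1 : A)) = _ • (𝟙 X.base ⊗ₜ[k] (1 : A))
    rw [TensorProduct.smul_tmul', TensorProduct.smul_tmul', HCategory.smul_id (k := k)]
  smul_comp {X Y Z} h u v r a b hab := by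
    change h • TensorCat.compL X.base Y.base Z.base u v =
      ∑ i, TensorCat.compL X.base Y.base Z.base (b i • u) (a i • v)
    induction u using TensorProduct.induction_on with
    | zero => simp
    | add x y hx hy =>
      simp only [map_add, LinearMap.add_apply, smul_add, hx, hy, Finset.sum_add_distrib]
    | tmul f p =>
      induction v using TensorProduct.induction_on with
      | zero => simp
      | add x y hx hy =>
        simp only [map_add, smul_add, hx, hy, Finset.sum_add_distrib]
      | tmul g q =>
        simp only [TensorProduct.smul_tmul', TensorCat.compL_tmul,
          HCategory.smul_comp h f g r a b hab, TensorProduct.sum_tmul]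
        exact Finset.sum_congr rfl fun i _ => (TensorCat.compL_tmul (b i • f) (a i • g) p q).symm

/-! ## Stable anti-Yetter-Drinfeld modules -/

/-- A right-left stable anti-Yetter-Drinfeld module `M` over `H`: a right `H`-module
(the right action `m h` is `MulOpposite.op h • m`) and a left `H`-comodule with
`ρ(m h) = S(h₃) m₍₋₁₎ h₁ ⊗ m₍₀₎ h₂` and `m₍₀₎ m₍₋₁₎ = m`. Sweedler sums are written out for
arbitrary expressions of the tensors involved as finite sums. -/
class SAYDModule (k : Type uk) (H : Type uH) (M : Type uM) [Field k] [Ring H] [HopfAlgebra k H]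
    [AddCommGroup M] [Module k M] [Module Hᵐᵒᵖ M] [IsScalarTower k Hᵐᵒᵖ M] where
  coaction : M →ₗ[k] H ⊗[k] M
  coassoc : ∀ m : M, TensorProduct.assoc k H H M
      (LinearMap.rTensor M (Coalgebra.comul (R := k) (A := H)) (coaction m)) =
    LinearMap.lTensor H coaction (coaction m)
  counit_coaction : ∀ m : M, TensorProduct.lid k M
      (LinearMap.rTensor M (Coalgebra.counit (R := k) (A := H)) (coaction m)) = m
  coaction_smul : ∀ (m : M) (h : H) (r : ℕ) (a b c : Fin r → H) (s : ℕ) (x : Fin s → H)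
      (y : Fin s → M),
    LinearMap.lTensor H (Coalgebra.comul (R := k) (A := H)) (Coalgebra.comul (R := k) h) =
      ∑ i, a i ⊗ₜ[k] (b i ⊗ₜ[k] c i) →
    coaction m = ∑ j, x j ⊗ₜ[k] y j →
    coaction (MulOpposite.op h • m) =
      ∑ i, ∑ j, (HopfAlgebra.antipode k (c i) * x j * a i) ⊗ₜ[k] (MulOpposite.op (b i) • y j)
  stable : ∀ (m : M) (s : ℕ) (x : Fin s → H) (y : Fin s → M),
    coaction m = ∑ j, x j ⊗ₜ[k] y j → ∑ j, MulOpposite.op (x j) • y j = m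

/-! ## The cyclic nerve -/

section Objects

variable {D : Type uD}

/-- The objects `(X₀, …, X_i, X_{i+2}, …, X_{n+1})`. -/
def faceObj {n : ℕ} (i : Fin (n + 1)) (X : Fin (n + 2) → D) : Fin (n + 1) → D :=
  fun j => X (i.succ.succAbove j)

theorem faceObj_of_le {n : ℕ} {i j : Fin (n + 1)} (X : Fin (n + 2) → D) (h : j ≤ i) :
    X j.castSucc = faceObj i X j := by
  unfold faceObj
  rw [Fin.succAbove_of_castSucc_lt]
  exact Fin.castSucc_lt_succ_iff.mpr h

theorem faceObj_of_lt {n : ℕ} {i j : Fin (n + 1)} (X : Fin (n + 2) → D) (h : i < j) :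
    X j.succ = faceObj i X j := by
  unfold faceObj
  rw [Fin.succAbove_of_le_castSucc]
  exact Fin.succ_le_castSucc_iff.mpr h

theorem succ_obj_eq {n : ℕ} (j : Fin (n + 1)) (X : Fin (n + 2) → D) :
    X j.succ = X (j.castSucc + 1) := by
  congr 1
  apply Fin.ext
  simp

theorem faceObj_add_one_of_lt {n : ℕ} {i j : Fin (n + 1)} (X : Fin (n + 2) → D) (h : j < i) :
    faceObj i X (j + 1) = X (j.castSucc + 1) := by
  have h1 : j + 1 ≤ i := Fin.add_one_le_of_lt h
  rw [← faceObj_of_le X h1]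
  congr 1
  have hj : j.val < n := by have := i.isLt; have : j.val < i.val := h; omega
  apply Fin.ext
  simp [Fin.val_add, hj]

theorem faceObj_add_one_of_ge {n : ℕ} {i j : Fin (n + 1)} (X : Fin (n + 2) → D) (h : i ≤ j) :
    faceObj i X (j + 1) = X (j.succ + 1) := by
  have h' : i.val ≤ j.val := h
  by_cases hj : j.val = n
  · have e1 : j + 1 = 0 := by apply Fin.ext; simp [Fin.val_add, hj]
    have e2 : j.succ + 1 = 0 := by apply Fin.ext; simp [Fin.val_add, hj]
    rw [e1, e2, ← faceObj_of_le X (Fin.zero_le i)]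
    rfl
  · have hlt : j.val < n := by have := j.isLt; omega
    have e1 : (j + 1).val = j.val + 1 := by
      simp [Fin.val_add, hlt]
    rw [← faceObj_of_lt X (show i < j + 1 by rw [Fin.lt_def, e1]; omega)]
    congr 1
    apply Fin.ext
    rw [Fin.val_succ, e1, Fin.val_add, Fin.val_succ, Fin.val_one, Nat.mod_eq_of_lt (by omega)]

/-- The objects `(X_n, X₀, …, X_{n-1})`. -/
def rotObj {n : ℕ} (X : Fin (n + 1) → D) : Fin (n + 1) → D := fun i => X (i - 1)

theorem rotObj_add_one {n : ℕ} (X : Fin (n + 1) → D) (i : Fin (n + 1)) :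
    rotObj X (i + 1) = X (i - 1 + 1) := by
  simp [rotObj]

end Objects

section Faces

variable {D : Type uD} [Category.{vD} D]

/-- The family `(f⁰, …, fⁱ ∘ fⁱ⁺¹, …, fⁿ⁺¹)`; the `eqToHom`s only identify equal objects. -/
def faceFun {n : ℕ} (i : Fin (n + 1)) (X : Fin (n + 2) → D)
    (f : ∀ l : Fin (n + 2), X (l + 1) ⟶ X l) (j : Fin (n + 1)) :
    faceObj i X (j + 1) ⟶ faceObj i X j :=
  if h : j < i then
    eqToHom (faceObj_add_one_of_lt X h) ≫ f j.castSucc ≫ eqToHom (faceObj_of_le X h.le)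
  else if h' : j = i then
    eqToHom (faceObj_add_one_of_ge X (not_lt.mp h)) ≫ f j.succ ≫ eqToHom (succ_obj_eq j X) ≫
      f j.castSucc ≫ eqToHom (faceObj_of_le X h'.le)
  else
    eqToHom (faceObj_add_one_of_ge X (not_lt.mp h)) ≫ f j.succ ≫
      eqToHom (faceObj_of_lt X (lt_of_le_of_ne (not_lt.mp h) (Ne.symm h')))

/-- The family `(fⁿ, f⁰, …, fⁿ⁻¹)`; the `eqToHom` only identifies equal objects. -/
def rotFun {n : ℕ} (X : Fin (n + 1) → D) (f : ∀ l : Fin (n + 1), X (l + 1) ⟶ X l)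
    (i : Fin (n + 1)) : rotObj X (i + 1) ⟶ rotObj X i :=
  eqToHom (rotObj_add_one X i) ≫ f (i - 1)

theorem faceFun_update {n : ℕ} (i : Fin (n + 1)) (X : Fin (n + 2) → D)
    (f : ∀ l : Fin (n + 2), X (l + 1) ⟶ X l) (l : Fin (n + 2)) (x : X (l + 1) ⟶ X l) :
    faceFun i X (Function.update f l x) =
      Function.update (faceFun i X f) (i.predAbove l)
        (faceFun i X (Function.update f l x) (i.predAbove l)) := by
  funext j
  by_cases hj : j = i.predAbove l
  · subst hj; simp
  · rw [Function.update_of_ne hj]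
    have h1 : j ≤ i → j.castSucc ≠ l := by
      rintro h rfl
      exact hj (by rw [Fin.predAbove_castSucc_of_le _ _ h])
    have h2 : i ≤ j → j.succ ≠ l := by
      rintro h rfl
      exact hj (by rw [Fin.predAbove_succ_of_le _ _ h])
    unfold faceFun
    split_ifs with h h'
    · rw [Function.update_of_ne (h1 h.le)]
    · rw [Function.update_of_ne (h1 h'.le), Function.update_of_ne (h2 h'.ge)]
    · rw [Function.update_of_ne (h2 (not_lt.mp h))]

theorem rotFun_update {n : ℕ} (X : Fin (n + 1) → D)
    (f : ∀ l : Fin (n + 1), X (l + 1) ⟶ X l) (l : Fin (n + 1)) (x : X (l + 1) ⟶ X l) :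
    rotFun X (Function.update f l x) =
      Function.update (rotFun X f) (l + 1) (rotFun X (Function.update f l x) (l + 1)) := by
  funext j
  by_cases hj : j = l + 1
  · subst hj; simp
  · rw [Function.update_of_ne hj]
    have h1 : j - 1 ≠ l := by
      rintro rfl
      exact hj (by simp)
    unfold rotFun
    rw [Function.update_of_ne h1]

end Faces

section FacesLinear

variable {D : Type uD} [Category.{vD} D] [Preadditive D]

theorem faceFun_update_add {n : ℕ} (i : Fin (n + 1)) (X : Fin (n + 2) → D)
    (f : ∀ l : Fin (n + 2), X (l + 1) ⟶ X l) (l : Fin (n + 2)) (x y : X (l + 1) ⟶ X l)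
    (j : Fin (n + 1)) (hj : j = i.predAbove l) :
    faceFun i X (Function.update f l (x + y)) j =
      faceFun i X (Function.update f l x) j + faceFun i X (Function.update f l y) j := by
  have h0 : l = j.castSucc ∧ j ≤ i ∨ l = j.succ ∧ i ≤ j := by
    subst hj
    rcases le_or_gt l i.castSucc with h | h
    · left
      rw [Fin.predAbove_of_le_castSucc _ _ h]
      exact ⟨by simp, h⟩
    · right
      rw [Fin.predAbove_of_castSucc_lt _ _ h]
      exact ⟨by simp, by
        rw [Fin.le_def, Fin.val_pred]
        have : i.val < l.val := h
        omega⟩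
  have hne : j.castSucc ≠ j.succ := (Fin.castSucc_lt_succ).ne
  rcases h0 with ⟨rfl, h⟩ | ⟨rfl, h⟩
  · unfold faceFun
    split_ifs with h1 h2
    · simp
    · simp [Function.update_of_ne hne.symm]
    · exact absurd (lt_of_le_of_ne h h2) h1
  · unfold faceFun
    split_ifs with h1 h2
    · exact absurd h (not_le.mpr h1)
    · simp [Function.update_of_ne hne]
    · simp

theorem faceFun_update_smul {k : Type uk} [Field k] [Linear k D] {n : ℕ} (i : Fin (n + 1))
    (X : Fin (n + 2) → D) (f : ∀ l : Fin (n + 2), X (l + 1) ⟶ X l) (l : Fin (n + 2)) (c : k)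
    (x : X (l + 1) ⟶ X l) (j : Fin (n + 1)) (hj : j = i.predAbove l) :
    faceFun i X (Function.update f l (c • x)) j =
      c • faceFun i X (Function.update f l x) j := by
  have h0 : l = j.castSucc ∧ j ≤ i ∨ l = j.succ ∧ i ≤ j := by
    subst hj
    rcases le_or_gt l i.castSucc with h | h
    · left
      rw [Fin.predAbove_of_le_castSucc _ _ h]
      exact ⟨by simp, h⟩
    · right
      rw [Fin.predAbove_of_castSucc_lt _ _ h]
      exact ⟨by simp, by
        rw [Fin.le_def, Fin.val_pred]
        have : i.val < l.val := h
        omega⟩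
  have hne : j.castSucc ≠ j.succ := (Fin.castSucc_lt_succ).ne
  rcases h0 with ⟨rfl, h⟩ | ⟨rfl, h⟩
  · unfold faceFun
    split_ifs with h1 h2
    · simp
    · simp [Function.update_of_ne hne.symm]
    · exact absurd (lt_of_le_of_ne h h2) h1
  · unfold faceFun
    split_ifs with h1 h2
    · exact absurd h (not_le.mpr h1)
    · simp [Function.update_of_ne hne]
    · simp

end FacesLinear

section Nerve

variable (k : Type uk) {D : Type uD} [Field k] [Category.{vD} D] [Preadditive D] [Linear k D]

/-- `Hom(X₁, X₀) ⊗ Hom(X₂, X₁) ⊗ ⋯ ⊗ Hom(X₀, Xₙ)`; the index `i + 1` is taken modulo `n + 1`. -/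
abbrev HomTensor {n : ℕ} (X : Fin (n + 1) → D) :=
  ⨂[k] i : Fin (n + 1), (X (i + 1) ⟶ X i)

variable (D) in
/-- The cyclic nerve `CN_n(D) = ⨁_{(X₀, …, Xₙ)} Hom(X₁, X₀) ⊗ Hom(X₂, X₁) ⊗ ⋯ ⊗ Hom(X₀, Xₙ)`. -/
abbrev CN (n : ℕ) :=
  DirectSum (Fin (n + 1) → D) fun X => HomTensor k X

variable {k}

/-- The inclusion of a summand in the cyclic nerve. -/
def CN.incl {n : ℕ} (X : Fin (n + 1) → D) : HomTensor k X →ₗ[k] CN k D n :=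
  letI := Classical.decEq (Fin (n + 1) → D)
  DirectSum.lof k (Fin (n + 1) → D) (fun X => HomTensor k X) X

/-- The linear map out of the cyclic nerve given by its restrictions to the summands. -/
def CN.desc {n : ℕ} {N : Type*} [AddCommMonoid N] [Module k N]
    (F : ∀ X : Fin (n + 1) → D, HomTensor k X →ₗ[k] N) : CN k D n →ₗ[k] N :=
  letI := Classical.decEq (Fin (n + 1) → D)
  DirectSum.toModule k (Fin (n + 1) → D) N F

@[simp] theorem CN.desc_incl {n : ℕ} {N : Type*} [AddCommMonoid N] [Module k N]
    (F : ∀ X : Fin (n + 1) → D, HomTensor k X →ₗ[k] N) (X : Fin (n + 1) → D)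
    (t : HomTensor k X) : CN.desc F (CN.incl X t) = F X t := by
  classical
  simp [CN.desc, CN.incl]

/-- The element `f⁰ ⊗ ⋯ ⊗ fⁿ` of `CN_n(D)`. -/
def CN.gen (k : Type uk) [Field k] [Linear k D] {n : ℕ} (X : Fin (n + 1) → D)
    (f : ∀ i : Fin (n + 1), X (i + 1) ⟶ X i) : CN k D n :=
  CN.incl X (PiTensorProduct.tprod k f)

theorem CN.desc_gen {n : ℕ} {N : Type*} [AddCommMonoid N] [Module k N]
    (F : ∀ X : Fin (n + 1) → D, HomTensor k X →ₗ[k] N) (X : Fin (n + 1) → D)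
    (f : ∀ i : Fin (n + 1), X (i + 1) ⟶ X i) :
    CN.desc F (CN.gen k X f) = F X (PiTensorProduct.tprod k f) :=
  CN.desc_incl F X _

/-! ### Structure maps on the cyclic nerve -/

/-- `f⁰ ⊗ ⋯ ⊗ fⁿ⁺¹ ↦ f⁰ ⊗ ⋯ ⊗ (fⁱ ∘ fⁱ⁺¹) ⊗ ⋯ ⊗ fⁿ⁺¹` on one summand. -/
def faceTensor {n : ℕ} (i : Fin (n + 1)) (X : Fin (n + 2) → D) :
    HomTensor k X →ₗ[k] HomTensor k (faceObj i X) :=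
  PiTensorProduct.lift
    { toFun := fun f => PiTensorProduct.tprod k (faceFun i X f)
      map_update_add' := by
        intro inst f l x y
        obtain rfl : inst = instDecidableEqFin _ := Subsingleton.elim _ _
        rw [faceFun_update i X f l (x + y), faceFun_update i X f l x, faceFun_update i X f l y,
          faceFun_update_add i X f l x y _ rfl, MultilinearMap.map_update_add]
      map_update_smul' := by
        intro inst f l c x
        obtain rfl : inst = instDecidableEqFin _ := Subsingleton.elim _ _
        rw [faceFun_update i X f l (c • x), faceFun_update i X f l x,
          faceFun_update_smul i X f l c x _ rfl, MultilinearMap.map_update_smul] }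

/-- `CN_{n+1}(D) → CN_n(D)`,
`f⁰ ⊗ ⋯ ⊗ fⁿ⁺¹ ↦ f⁰ ⊗ ⋯ ⊗ (fⁱ ∘ fⁱ⁺¹) ⊗ ⋯ ⊗ fⁿ⁺¹`, for `0 ≤ i ≤ n`. -/
def CN.face {n : ℕ} (i : Fin (n + 1)) : CN k D (n + 1) →ₗ[k] CN k D n :=
  CN.desc fun X => CN.incl (faceObj i X) ∘ₗ faceTensor i X

theorem CN.face_gen {n : ℕ} (i : Fin (n + 1)) (X : Fin (n + 2) → D)
    (f : ∀ l : Fin (n + 2), X (l + 1) ⟶ X l) :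
    CN.face i (CN.gen k X f) = CN.gen k (faceObj i X) (faceFun i X f) := by
  simp [CN.face, CN.gen, faceTensor]

/-- `f⁰ ⊗ ⋯ ⊗ fⁿ ↦ fⁿ ⊗ f⁰ ⊗ ⋯ ⊗ fⁿ⁻¹` on one summand. -/
def rotTensor {n : ℕ} (X : Fin (n + 1) → D) : HomTensor k X →ₗ[k] HomTensor k (rotObj X) :=
  PiTensorProduct.lift
    { toFun := fun f => PiTensorProduct.tprod k (rotFun X f)
      map_update_add' := by
        intro inst f l x y
        obtain rfl : inst = instDecidableEqFin _ := Subsingleton.elim _ _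
        have h : rotFun X (Function.update f l (x + y)) (l + 1) =
            rotFun X (Function.update f l x) (l + 1) +
              rotFun X (Function.update f l y) (l + 1) := by
          unfold rotFun
          have key : ∀ (p : Fin (n + 1)) (hp : p = l),
              Function.update f l (x + y) p =
                Function.update f l x p + Function.update f l y p := by
            rintro p rfl; simp
          rw [key _ (by simp)]
          exact Preadditive.comp_add _ _ _ _ _ _
        rw [rotFun_update X f l (x + y), rotFun_update X f l x, rotFun_update X f l y, h,
          MultilinearMap.map_update_add]
      map_update_smul' := by
        intro inst f l c x
        obtain rfl : inst = instDecidableEqFin _ := Subsingleton.elim _ _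
        have h : rotFun X (Function.update f l (c • x)) (l + 1) =
            c • rotFun X (Function.update f l x) (l + 1) := by
          unfold rotFun
          have key : ∀ (p : Fin (n + 1)) (hp : p = l),
              Function.update f l (c • x) p = c • Function.update f l x p := by
            rintro p rfl; simp
          rw [key _ (by simp)]
          exact Linear.comp_smul _ _ _ _ _ _
        rw [rotFun_update X f l (c • x), rotFun_update X f l x, h,
          MultilinearMap.map_update_smul] }

variable (k) {H : Type uH} [Ring H] [HopfAlgebra k H] [HModuleHoms k H D]

/-- The action of `H` on `Hom(X, Y)`, as a linear map `H → End_k(Hom(X, Y))`. -/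
def homAct (X Y : D) : H →ₗ[k] (X ⟶ Y) →ₗ[k] (X ⟶ Y) :=
  LinearMap.mk₂ k (fun h f => h • f) (fun a b f => add_smul a b f)
    (fun c a f => smul_assoc c a f) (fun a f g => smul_add a f g)
    (fun c a f => smul_comm a c f)

/-- The action `a ↦ (f⁰ ⊗ f¹ ⊗ ⋯ ⊗ fⁿ ↦ (a f⁰) ⊗ f¹ ⊗ ⋯ ⊗ fⁿ)` on the first factor. -/
def actFirst {n : ℕ} (X : Fin (n + 1) → D) : H →ₗ[k] HomTensor k X →ₗ[k] HomTensor k X :=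
  (PiTensorProduct.mapMultilinear k (fun i : Fin (n + 1) => (X (i + 1) ⟶ X i))
      (fun i : Fin (n + 1) => (X (i + 1) ⟶ X i))).toLinearMap (fun _ => LinearMap.id) 0 ∘ₗ
    homAct k (X (0 + 1)) (X 0)

/-- `a ↦ (f⁰ ⊗ ⋯ ⊗ fⁿ ↦ (a fⁿ) ⊗ f⁰ ⊗ ⋯ ⊗ fⁿ⁻¹)` on the cyclic nerve. -/
def CN.twistedRot {n : ℕ} : H →ₗ[k] CN k D n →ₗ[k] CN k D n :=
  (CN.desc fun X =>
    (((actFirst k (H := H) (rotObj X)).compl₂ (rotTensor X)).compr₂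
      (CN.incl (rotObj X))).flip).flip

theorem CN.twistedRot_gen {n : ℕ} (a : H) (X : Fin (n + 1) → D)
    (f : ∀ l : Fin (n + 1), X (l + 1) ⟶ X l) :
    CN.twistedRot k a (CN.gen k X f) =
      CN.gen k (rotObj X) (Function.update (rotFun X f) 0 (a • rotFun X f 0)) := by
  simp only [CN.twistedRot, CN.gen, CN.desc_incl, LinearMap.flip_apply, LinearMap.compr₂_apply,
    LinearMap.compl₂_apply, actFirst, rotTensor, LinearMap.comp_apply,
    MultilinearMap.toLinearMap_apply, PiTensorProduct.lift.tprod, MultilinearMap.coe_mk,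
    PiTensorProduct.mapMultilinear_apply, PiTensorProduct.map_tprod]
  congr 2
  funext i
  by_cases hi : i = 0
  · subst hi; simp [homAct]
  · simp [Function.update_of_ne hi]

/-- The diagonal left action `h (f⁰ ⊗ ⋯ ⊗ fⁿ) = h₁ f⁰ ⊗ ⋯ ⊗ h_{n+1} fⁿ` on the cyclic nerve. -/
def CN.act {n : ℕ} : H →ₗ[k] CN k D n →ₗ[k] CN k D n :=
  (CN.desc fun X =>
    ((PiTensorProduct.map₂ (fun i : Fin (n + 1) => homAct k (H := H) (X (i + 1)) (X i)) ∘ₗ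
      iterComul k H n).compr₂ (CN.incl X)).flip).flip

end Nerve

/-! ## Hopf-cyclic cohomology -/

section Cohomology

variable (k : Type uk) (H : Type uH) (D : Type uD) (M : Type uM)
  [Field k] [Ring H] [HopfAlgebra k H]
  [Category.{vD} D] [Preadditive D] [Linear k D] [HCategory k H D]
  [AddCommGroup M] [Module k M]

/-- `C_n(D, M) = M ⊗ CN_n(D)`. -/
abbrev Chain (n : ℕ) := M ⊗[k] CN k D n

/-- `C^n(D, M) = Hom_k(M ⊗ CN_n(D), k)`. -/
abbrev Cochain (n : ℕ) := Chain k D M n →ₗ[k] k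

variable {D} in
/-- `d_i(m ⊗ f⁰ ⊗ ⋯ ⊗ fⁿ⁺¹) = m ⊗ f⁰ ⊗ ⋯ ⊗ (fⁱ ∘ fⁱ⁺¹) ⊗ ⋯ ⊗ fⁿ⁺¹` for `0 ≤ i ≤ n`. -/
def chainFace {n : ℕ} (i : Fin (n + 1)) : Chain k D M (n + 1) →ₗ[k] Chain k D M n :=
  LinearMap.lTensor M (CN.face i)

variable [Module Hᵐᵒᵖ M] [IsScalarTower k Hᵐᵒᵖ M]

/-- The right action of `H` on `M`, as a linear map `H → End_k(M)`, `h ↦ (m ↦ m h)`. -/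
def rightAct : H →ₗ[k] M →ₗ[k] M :=
  LinearMap.mk₂ k (fun h m => MulOpposite.op h • m)
    (fun a b m => by rw [MulOpposite.op_add, add_smul])
    (fun c a m => by rw [MulOpposite.op_smul, smul_assoc])
    (fun a m m' => smul_add _ m m')
    (fun c a m => by
      rw [← algebraMap_smul (Hᵐᵒᵖ) c m, ← algebraMap_smul (Hᵐᵒᵖ) c (MulOpposite.op a • m),
        smul_smul, smul_smul, Algebra.commutes])

/-- The right action `(m ⊗ f⁰ ⊗ ⋯ ⊗ fⁿ) h = m h₁ ⊗ S(h₂)(f⁰ ⊗ ⋯ ⊗ fⁿ)` of `H` on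
`M ⊗ CN_n(D)`, as a linear map `H → End_k(M ⊗ CN_n(D))`. -/
def chainRightAct (n : ℕ) : H →ₗ[k] Chain k D M n →ₗ[k] Chain k D M n :=
  TensorProduct.lift
      ((TensorProduct.mapBilinear (RingHom.id k) M (CN k D n) M (CN k D n)).compl₁₂
        (rightAct k H M) (CN.act k ∘ₗ HopfAlgebra.antipode k)) ∘ₗ
    Coalgebra.comul

/-- `C^n_H(D, M) = Hom_H(M ⊗ CN_n(D), k)`, with `H` acting on `k` through the counit. -/
def HCochain (n : ℕ) : Submodule k (Cochain k D M n) where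
  carrier := {φ | ∀ (h : H) (c : Chain k D M n),
    φ (chainRightAct k H D M n h c) = Coalgebra.counit (R := k) h * φ c}
  add_mem' {φ ψ} hφ hψ h c := by
    rw [LinearMap.add_apply, LinearMap.add_apply, hφ h c, hψ h c, mul_add]
  zero_mem' h c := by simp
  smul_mem' r φ hφ h c := by
    rw [LinearMap.smul_apply, LinearMap.smul_apply, hφ h c, smul_eq_mul, smul_eq_mul,
      mul_left_comm]

variable [SAYDModule k H M] [BijectiveAntipode k H]

/-- `t_n(m ⊗ f⁰ ⊗ ⋯ ⊗ fⁿ) = m₍₀₎ ⊗ S⁻¹(m₍₋₁₎) fⁿ ⊗ f⁰ ⊗ ⋯ ⊗ fⁿ⁻¹`. -/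
def chainT (n : ℕ) : Chain k D M n →ₗ[k] Chain k D M n :=
  TensorProduct.lift
      (LinearMap.lTensorHom M ∘ₗ CN.twistedRot k ∘ₗ antipodeInv k H) ∘ₗ
    (TensorProduct.assoc k H M (CN k D n)).toLinearMap ∘ₗ
    LinearMap.rTensor (CN k D n) (SAYDModule.coaction (k := k) (H := H) (M := M))

theorem chainT_gen {n : ℕ} (m : M) (X : Fin (n + 1) → D)
    (f : ∀ l : Fin (n + 1), X (l + 1) ⟶ X l) (s : ℕ) (x : Fin s → H) (y : Fin s → M)
    (hm : SAYDModule.coaction (k := k) (H := H) m = ∑ j, x j ⊗ₜ[k] y j) :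
    chainT k H D M n (m ⊗ₜ[k] CN.gen k X f) =
      ∑ j, y j ⊗ₜ[k] CN.gen k (rotObj X)
        (Function.update (rotFun X f) 0 (antipodeInv k H (x j) • rotFun X f 0)) := by
  simp [chainT, hm, TensorProduct.sum_tmul, CN.twistedRot_gen]

/-- The last face
`d_{n+1}(m ⊗ f⁰ ⊗ ⋯ ⊗ fⁿ⁺¹) = m₍₀₎ ⊗ (S⁻¹(m₍₋₁₎) fⁿ⁺¹) ∘ f⁰ ⊗ f¹ ⊗ ⋯ ⊗ fⁿ`. -/
def chainLastFace (n : ℕ) : Chain k D M (n + 1) →ₗ[k] Chain k D M n :=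
  chainFace k M 0 ∘ₗ chainT k H D M (n + 1)

/-- The (unsigned) cyclic operator `τ_n φ = φ ∘ t_n`. -/
def tau (n : ℕ) : Cochain k D M n →ₗ[k] Cochain k D M n :=
  (chainT k H D M n).lcomp k k

/-- The signed cyclic operator `λ_n = (-1)ⁿ τ_n`. -/
def lam (n : ℕ) : Cochain k D M n →ₗ[k] Cochain k D M n :=
  (-1 : k) ^ n • tau k H D M n

/-- The Hochschild differential `b = ∑_{i=0}^{n+1} (-1)ⁱ δ_i`, where `δ_i φ = φ ∘ d_i`. -/
def hochschildB (n : ℕ) : Cochain k D M n →ₗ[k] Cochain k D M (n + 1) :=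
  ∑ i : Fin (n + 1), (-1 : k) ^ (i : ℕ) • (chainFace k M i).lcomp k k +
    (-1 : k) ^ (n + 1) • (chainLastFace k H D M n).lcomp k k

/-- `C^n_λ = Ker(1 - λ) ⊆ C^n_H(D, M)`. -/
def CyclicCochain (n : ℕ) : Submodule k (Cochain k D M n) :=
  HCochain k H D M n ⊓ LinearMap.ker (LinearMap.id - lam k H D M n)

/-- The cyclic cocycles `Z^n_H(D, M)`. -/
def Cocycles (n : ℕ) : Submodule k (Cochain k D M n) :=
  CyclicCochain k H D M n ⊓ LinearMap.ker (hochschildB k H D M n)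

/-- The cyclic coboundaries `B^n_H(D, M) = b(C^{n-1}_λ)`, with `B^0_H(D, M) = 0`. -/
def Coboundaries : (n : ℕ) → Submodule k (Cochain k D M n)
  | 0 => ⊥
  | n + 1 => (CyclicCochain k H D M n).map (hochschildB k H D M n)

set_option maxSynthPendingDepth 6 in
/-- Hopf-cyclic cohomology `HC^n_H(D, M) = Z^n_H(D, M) / B^n_H(D, M)`, the cohomology of the
complex `C^0_λ → C^1_λ → ⋯` with differential `b`. -/
abbrev HC (n : ℕ) :=
  Cocycles k H D M n ⧸ (Coboundaries k H D M n).comap (Cocycles k H D M n).subtype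

end Cohomology

end HopfCyclic

end

noncomputable section

namespace HopfCyclic

universe uk uH uD vD uC vC uM uA

set_option linter.unusedSectionVars false

/-! Let `φ` be a cyclic cocycle on `D` and `α(f) = f ⊗ E₁₁ + υ(f) ⊗ E₂₂`. Composing `φ` with the
matrix trace gives a cyclic cocycle on `D ⊗ M₂(k)`. Its pullback along `α` is `φ + υ*φ`, and its
pullback along the conjugate of `α` by `η`, which is `f ↦ υ(f) ⊗ E₂₂`, is `υ*φ`. If conjugation by
an invariant family of automorphisms does not change cohomology classes, then `φ + υ*φ` and `υ*φ`
are cohomologous, so `φ` is a coboundary (`cocycles_le_coboundaries`).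

Invariance under conjugation (`exists_coboundary_conj`) is proved by a polynomial homotopy. For an
invariant family `u`, let `γ(f)` be the `2 × 2` matrix over `k[t]` equal to the column `((1 - t), t
u)` times `α(f)` times the row `(1, u⁻¹)`. The row times the column is `(1 - t) + t = 1`, so `γ` is
a semifunctor. Under the trace, `t = 0` gives `α` and `t = 1` gives its conjugate. If `x` is the
`t`-derivative of the matrix built in the same way from the identity, then `x ∘ γ(f) = γ(f)'` and
`γ(f) ∘ x = 0`. The derivative of the path is thus the commutator with the invariant family `x`. The
functional `∫₀¹ tr` is a trace on `M₂(k[t])`, and integrating the derivative yields the difference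
of the two ends.

It remains to see that inner derivations by invariant families send cyclic cocycles to coboundaries
(`commutator_mem_coboundaries`). The homotopy is the alternating sum of the insertions of `x` after
each factor (`boundary_insAlt`). Invariance of `x` makes the insertions compatible with the
`H`-action and with the twisted rotation. -/

/-! ## Total morphisms -/

/-- A morphism of `D` together with its source and target. -/
structure Mor (D : Type uD) [Category.{vD} D] where
  dom : D
  cod : D
  hom : dom ⟶ cod

namespace Mor

variable {D : Type uD} [Category.{vD} D]

/-- The total morphism of `f`. -/
abbrev of {X Y : D} (f : X ⟶ Y) : Mor D := ⟨X, Y, f⟩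

theorem of_injective {X Y : D} {f g : X ⟶ Y} (h : of f = of g) : f = g := by
  cases h; rfl

-- Transports disappear on total morphisms. Identities in the nerve, whose types depend on index
-- arithmetic, can therefore be compared without casts.
@[simp] theorem of_eqToHom_comp {X X' Y : D} (h : X' = X) (f : X ⟶ Y) :
    of (eqToHom h ≫ f) = of f := by
  subst h; simp

@[simp] theorem of_comp_eqToHom {X Y Y' : D} (h : Y = Y') (f : X ⟶ Y) :
    of (f ≫ eqToHom h) = of f := by
  subst h; simp

open Classical in
/-- The composite `a ∘ b` if it makes sense, and `a` otherwise. -/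
def comp (a b : Mor D) : Mor D :=
  -- The default value `a` has the target of `a`, so `cod_comp` needs no composability condition.
  if h : b.cod = a.dom then of (b.hom ≫ eqToHom h ≫ a.hom) else a

theorem comp_of {X Y Z : D} (f : X ⟶ Y) (g : Y ⟶ Z) : comp (of g) (of f) = of (f ≫ g) := by
  simp [comp]

theorem comp_of_eqToHom {X Y Y' Z : D} (h : Y = Y') (f : X ⟶ Y) (g : Y' ⟶ Z) :
    of (f ≫ eqToHom h ≫ g) = comp (of g) (of f) := by
  subst h; simp [comp_of]

theorem cod_comp (a b : Mor D) : (comp a b).cod = a.cod := by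
  unfold comp; split_ifs <;> rfl

/-- A map on all morphism spaces that keeps source and target, on total morphisms. -/
def app (g : ∀ X Y : D, (X ⟶ Y) → (X ⟶ Y)) (a : Mor D) : Mor D := of (g _ _ a.hom)

end Mor

/-! ### Cyclic families as periodic sequences of total morphisms. -/

section Arr

variable {D : Type uD} [Category.{vD} D]

/-- The `j`-th morphism of a cyclic family, the index `j` being taken modulo `n + 1`. -/
def arr {n : ℕ} {X : Fin (n + 1) → D} (f : ∀ l : Fin (n + 1), X (l + 1) ⟶ X l) (j : ℕ) : Mor D :=
  Mor.of (f (Fin.ofNat (n + 1) j))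

theorem arr_val {n : ℕ} {X : Fin (n + 1) → D} (f : ∀ l : Fin (n + 1), X (l + 1) ⟶ X l)
    (l : Fin (n + 1)) : arr f l = Mor.of (f l) := by
  unfold arr
  rw [Fin.ofNat_val_eq_self]

theorem fin_ofNat_succ (n j : ℕ) : Fin.ofNat (n + 1) (j + 1) = Fin.ofNat (n + 1) j + 1 := by
  apply Fin.ext; simp [Fin.val_add]

/-- The index is cyclic, so this includes the wrap-around from `n` to `0`. -/
theorem arr_dom {n : ℕ} {X : Fin (n + 1) → D} (f : ∀ l : Fin (n + 1), X (l + 1) ⟶ X l) (j : ℕ) :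
    (arr f j).dom = (arr f (j + 1)).cod := by
  simp only [arr]
  rw [fin_ofNat_succ]

theorem arr_add {n : ℕ} {X : Fin (n + 1) → D} (f : ∀ l : Fin (n + 1), X (l + 1) ⟶ X l) (j : ℕ) :
    arr f (j + (n + 1)) = arr f j := by
  unfold arr
  have : Fin.ofNat (n + 1) (j + (n + 1)) = Fin.ofNat (n + 1) j := by apply Fin.ext; simp
  rw [this]

theorem arr_last {n : ℕ} {X : Fin (n + 1) → D} (f : ∀ l : Fin (n + 1), X (l + 1) ⟶ X l) :
    arr f (n + 1) = arr f 0 := by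
  rw [← arr_add f 0, zero_add]

theorem arr_faceFun {n : ℕ} (i : Fin (n + 1)) (X : Fin (n + 2) → D)
    (f : ∀ l : Fin (n + 2), X (l + 1) ⟶ X l) {j : ℕ} (hj : j ≤ n) :
    arr (faceFun i X f) j =
      if j < i then arr f j else if j = i then (arr f j).comp (arr f (j + 1))
      else arr f (j + 1) := by
  obtain ⟨j, rfl⟩ : ∃ q : Fin (n + 1), q.val = j := ⟨⟨j, by omega⟩, rfl⟩
  have e1 : arr f j.val = Mor.of (f j.castSucc) := arr_val f j.castSucc
  have e2 : arr f (j.val + 1) = Mor.of (f j.succ) := arr_val f j.succ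
  rw [arr_val, e1, e2]
  unfold faceFun
  by_cases h : j < i
  · rw [dif_pos h, if_pos (show j.val < i.val from h)]
    simp
  · by_cases h' : j = i
    · rw [dif_neg h, dif_pos h', if_neg (show ¬ j.val < i.val from h), if_pos (by rw [h'])]
      rw [Mor.of_eqToHom_comp, ← Mor.comp_of_eqToHom (succ_obj_eq j X), ← Category.assoc,
        ← Category.assoc, Mor.of_comp_eqToHom, Category.assoc]
    · rw [dif_neg h, dif_neg h', if_neg (show ¬ j.val < i.val from h),
        if_neg (fun e => h' (Fin.ext e))]
      simp

theorem arr_rotFun {n : ℕ} (X : Fin (n + 1) → D)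
    (f : ∀ l : Fin (n + 1), X (l + 1) ⟶ X l) (j : ℕ) :
    arr (rotFun X f) (j + 1) = arr f j := by
  unfold arr rotFun
  refine (Mor.of_eqToHom_comp _ _).trans ?_
  have h : ∀ p q, p = q → Mor.of (f p) = Mor.of (f q) := by rintro p _ rfl; rfl
  exact h _ _ (by rw [fin_ofNat_succ, add_sub_cancel_right])

theorem arr_rotFun_zero {n : ℕ} (X : Fin (n + 1) → D)
    (f : ∀ l : Fin (n + 1), X (l + 1) ⟶ X l) :
    arr (rotFun X f) 0 = arr f n := by
  rw [← arr_add _ 0, zero_add, arr_rotFun]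

theorem arr_update_zero {n : ℕ} {X : Fin (n + 1) → D}
    (f : ∀ l : Fin (n + 1), X (l + 1) ⟶ X l) (g : X (0 + 1) ⟶ X 0) {j : ℕ} (hj : j ≤ n) :
    arr (Function.update f 0 g) j = if j = 0 then Mor.of g else arr f j := by
  obtain ⟨j, rfl⟩ : ∃ q : Fin (n + 1), q.val = j := ⟨⟨j, by omega⟩, rfl⟩
  rw [arr_val, arr_val]
  by_cases h : j = 0
  · subst h; simp
  · rw [Function.update_of_ne h, if_neg (fun e : j.val = 0 => h (Fin.ext e))]

end Arr

/-! ## Insertion of an endomorphism -/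

section InsObj

variable {D : Type uD}

/-- The objects of the family in which an endomorphism of `X_p` is inserted at the `p`-th place. -/
def insObj {n : ℕ} (p : Fin (n + 2)) (X : Fin (n + 1) → D) (j : Fin (n + 2)) : D :=
  -- For `p = n + 1` the index wraps around, and the inserted morphism is an endomorphism of `X₀`.
  X (Fin.ofNat (n + 1) (if j.val ≤ p.val then j.val else j.val - 1))

theorem insObj_self {n : ℕ} (p : Fin (n + 2)) (X : Fin (n + 1) → D) :
    X (Fin.ofNat (n + 1) p) = insObj p X p := by simp [insObj]

theorem insObj_self_add_one {n : ℕ} (p : Fin (n + 2)) (X : Fin (n + 1) → D) :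
    X (Fin.ofNat (n + 1) p) = insObj p X (p + 1) := by
  unfold insObj
  congr 1
  by_cases hp : p.val = n + 1
  · have e : p + 1 = 0 := by apply Fin.ext; simp [Fin.val_add, hp]
    rw [e]; apply Fin.ext; simp [hp]
  · have := p.isLt
    have e : (p + 1).val = p.val + 1 := by
      rw [Fin.val_add, Fin.val_one, Nat.mod_eq_of_lt (by omega)]
    rw [e, if_neg (by omega)]; simp

theorem succAbove_val {n : ℕ} (p : Fin (n + 2)) (q : Fin (n + 1)) :
    (p.succAbove q).val = if q.val < p.val then q.val else q.val + 1 := by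
  unfold Fin.succAbove
  simp only [Fin.lt_def, Fin.val_castSucc]
  split_ifs <;> simp

theorem insObj_succAbove {n : ℕ} (p : Fin (n + 2)) (X : Fin (n + 1) → D) (q : Fin (n + 1)) :
    X q = insObj p X (p.succAbove q) := by
  unfold insObj
  congr 1
  rw [succAbove_val]
  apply Fin.ext
  split_ifs <;> first | omega | simp

theorem insObj_succAbove_add_one {n : ℕ} (p : Fin (n + 2)) (X : Fin (n + 1) → D)
    (q : Fin (n + 1)) : X (q + 1) = insObj p X (p.succAbove q + 1) := by
  unfold insObj
  congr 1
  have hs := succAbove_val p q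
  have hp := p.isLt
  have hq := q.isLt
  rw [← Fin.ofNat_val_eq_self q, ← fin_ofNat_succ]
  by_cases h : q.val = n ∧ p.val ≤ n
  · have e : p.succAbove q + 1 = 0 := by
      apply Fin.ext
      rw [Fin.val_add, hs, if_neg (by omega), h.1]; simp
    rw [Fin.ofNat_val_eq_self, e]; apply Fin.ext; simp [h.1]
  · have e : (p.succAbove q + 1).val = (p.succAbove q).val + 1 := by
      rw [Fin.val_add, Fin.val_one, Nat.mod_eq_of_lt]
      rw [hs]; split_ifs <;> omega
    rw [Fin.ofNat_val_eq_self, e, hs]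
    congr 1
    split_ifs <;> omega

end InsObj

/-! ### Generators of the nerve, insertions, and maps applied to one factor. -/

section Gen

variable {k : Type uk} [Field k] {D : Type uD} [Category.{vD} D] [Preadditive D] [Linear k D]

/-- The targets of the factors recover the objects, so equality of `X` and `X'` is a consequence of
the factorwise comparison. -/
theorem CN.gen_congr {n : ℕ} {X X' : Fin (n + 1) → D} {f : ∀ l : Fin (n + 1), X (l + 1) ⟶ X l}
    {f' : ∀ l : Fin (n + 1), X' (l + 1) ⟶ X' l} (h : ∀ j ≤ n, arr f j = arr f' j) :
    CN.gen k X f = CN.gen k X' f' := by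
  have h' : ∀ l, Mor.of (f l) = Mor.of (f' l) := fun l => by
    rw [← arr_val, ← arr_val]; exact h _ (Nat.le_of_lt_succ l.isLt)
  obtain rfl : X = X' := funext fun l => congrArg Mor.cod (h' l)
  obtain rfl : f = f' := funext fun l => Mor.of_injective (h' l)
  rfl

theorem CN.hom_ext {n : ℕ} {N : Type*} [AddCommMonoid N] [Module k N]
    {F G : CN k D n →ₗ[k] N}
    (h : ∀ (X : Fin (n + 1) → D) (f : ∀ l : Fin (n + 1), X (l + 1) ⟶ X l),
      F (CN.gen k X f) = G (CN.gen k X f)) : F = G := by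
  classical
  apply DirectSum.linearMap_ext
  intro X
  apply PiTensorProduct.ext
  ext f
  have := h X f
  simp only [CN.gen, CN.incl] at this
  simp only [LinearMap.compMultilinearMap_apply, LinearMap.comp_apply]
  convert this

/-- Transport of morphisms along equalities of source and target. -/
def castHom (k : Type uk) [Field k] [Linear k D] {X X' Y Y' : D} (h : X = X') (h' : Y = Y') :
    (X ⟶ Y) →ₗ[k] (X' ⟶ Y') :=
  Linear.leftComp k Y' (eqToHom h.symm) ∘ₗ Linear.rightComp k X (eqToHom h')

theorem castHom_apply {X X' Y Y' : D} (h : X = X') (h' : Y = Y') (f : X ⟶ Y) :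
    castHom k h h' f = eqToHom h.symm ≫ f ≫ eqToHom h' := rfl

@[simp] theorem of_castHom {X X' Y Y' : D} (h : X = X') (h' : Y = Y') (f : X ⟶ Y) :
    Mor.of (castHom k h h' f) = Mor.of f := by
  simp [castHom_apply]

variable (k)

/-- The family `(f⁰, …, x, …, fⁿ)` with `x` at the `p`-th place. -/
def insFun (x : ∀ X : D, X ⟶ X) {n : ℕ} (p : Fin (n + 2)) (X : Fin (n + 1) → D)
    (f : ∀ l : Fin (n + 1), X (l + 1) ⟶ X l) (j : Fin (n + 2)) :
    insObj p X (j + 1) ⟶ insObj p X j :=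
  p.insertNth (α := fun j => insObj p X (j + 1) ⟶ insObj p X j)
    (castHom k (insObj_self_add_one p X) (insObj_self p X) (x (X (Fin.ofNat (n + 1) p))))
    (fun q => castHom k (insObj_succAbove_add_one p X q) (insObj_succAbove p X q) (f q)) j

theorem arr_insFun (x : ∀ X : D, X ⟶ X) {n : ℕ} (p : Fin (n + 2)) (X : Fin (n + 1) → D)
    (f : ∀ l : Fin (n + 1), X (l + 1) ⟶ X l) {j : ℕ} (hj : j ≤ n + 1) :
    arr (insFun k x p X f) j =
      if j < p then arr f j else if j = p then Mor.of (x (arr f j).cod) else arr f (j - 1) := by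
  obtain ⟨j, rfl⟩ : ∃ q : Fin (n + 2), q.val = j := ⟨⟨j, by omega⟩, rfl⟩
  rw [arr_val]
  unfold insFun
  cases j using Fin.succAboveCases p with
  | x =>
    rw [Fin.insertNth_apply_same]
    simp [arr]
  | p q =>
    rw [Fin.insertNth_apply_succAbove]
    have hs := succAbove_val p q
    rw [of_castHom, ← arr_val f q]
    split_ifs at hs with h
    · rw [if_pos (by omega), hs]
    · rw [if_neg (by omega), if_neg (by omega), hs]; simp

/-- Insertion of `x` at the `p`-th place, on the cyclic nerve. -/
def CN.ins (x : ∀ X : D, X ⟶ X) {n : ℕ} (p : Fin (n + 2)) : CN k D n →ₗ[k] CN k D (n + 1) :=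
  CN.desc fun X => CN.incl (insObj p X) ∘ₗ PiTensorProduct.lift
    (((PiTensorProduct.tprod k
        (s := fun j : Fin (n + 2) => insObj p X (j + 1) ⟶ insObj p X j)).curryMid p
      (castHom k (insObj_self_add_one p X) (insObj_self p X)
        (x (X (Fin.ofNat (n + 1) p))))).compLinearMap
      (fun q => castHom k (insObj_succAbove_add_one p X q) (insObj_succAbove p X q)))

theorem CN.ins_gen (x : ∀ X : D, X ⟶ X) {n : ℕ} (p : Fin (n + 2)) (X : Fin (n + 1) → D)
    (f : ∀ l : Fin (n + 1), X (l + 1) ⟶ X l) :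
    CN.ins k x p (CN.gen k X f) = CN.gen k (insObj p X) (insFun k x p X f) := by
  simp only [CN.ins, CN.desc_gen, LinearMap.comp_apply, PiTensorProduct.lift.tprod]
  rfl

/-- This turns `h • x = ε(h) x` on the inserted factor into a scalar in front of the whole
insertion. -/
theorem CN.ins_smul (x : ∀ X : D, X ⟶ X) (r : k) {n : ℕ} (p : Fin (n + 2)) :
    CN.ins k (fun X => r • x X) p = r • CN.ins (D := D) (n := n) k x p := by
  refine CN.hom_ext fun X f => ?_
  simp only [LinearMap.smul_apply, CN.ins, CN.desc_gen, LinearMap.comp_apply, map_smul,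
    PiTensorProduct.lift.tprod, MultilinearMap.compLinearMap_apply, _root_.smul_apply]

/-- Application of `g` to the `l`-th factor of the cyclic nerve. -/
def CN.slot (g : ∀ X Y : D, (X ⟶ Y) →ₗ[k] (X ⟶ Y)) {n : ℕ} (l : Fin (n + 1)) :
    CN k D n →ₗ[k] CN k D n :=
  CN.desc fun X => CN.incl X ∘ₗ PiTensorProduct.map
    (fun j => if j = l then g (X (j + 1)) (X j) else LinearMap.id)

theorem CN.slot_gen (g : ∀ X Y : D, (X ⟶ Y) →ₗ[k] (X ⟶ Y)) {n : ℕ} (l : Fin (n + 1))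
    (X : Fin (n + 1) → D) (f : ∀ l : Fin (n + 1), X (l + 1) ⟶ X l) :
    CN.slot k g l (CN.gen k X f) =
      CN.gen k X (fun j => if j = l then g (X (j + 1)) (X j) (f j) else f j) := by
  simp only [CN.slot, CN.desc_gen, LinearMap.comp_apply, PiTensorProduct.map_tprod]
  unfold CN.gen
  congr 2
  funext j
  split_ifs <;> rfl

theorem arr_slot (g : ∀ X Y : D, (X ⟶ Y) →ₗ[k] (X ⟶ Y)) {n : ℕ} (l : Fin (n + 1))
    (X : Fin (n + 1) → D) (f : ∀ l : Fin (n + 1), X (l + 1) ⟶ X l) {j : ℕ} (hj : j ≤ n) :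
    arr (fun j => if j = l then g (X (j + 1)) (X j) (f j) else f j) j =
      if j = l then Mor.app (fun X Y => g X Y) (arr f j) else arr f j := by
  obtain ⟨j, rfl⟩ : ∃ q : Fin (n + 1), q.val = j := ⟨⟨j, by omega⟩, rfl⟩
  rw [arr_val, arr_val]
  by_cases h : j = l
  · subst h; simp [Mor.app]
  · rw [if_neg h, if_neg (fun e => h (Fin.ext e))]

end Gen

section InsertionRelations

variable (k : Type uk) [Field k] {D : Type uD} [Category.{vD} D] [Preadditive D] [Linear k D]

/-! ### Insertions and faces -/

/-- The target at a place decides which member of the family `x` is inserted there. The bound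
reaches `n + 1`, one beyond the last place, since an insertion after the last factor reads its
object cyclically. -/
theorem arr_faceFun_cod {n : ℕ} (i : Fin (n + 1)) (X : Fin (n + 2) → D)
    (f : ∀ l : Fin (n + 2), X (l + 1) ⟶ X l) {j : ℕ} (hj : j ≤ n + 1) :
    (arr (faceFun i X f) j).cod = if j ≤ i then (arr f j).cod else (arr f (j + 1)).cod := by
  have hi := i.isLt
  rcases Nat.lt_or_ge j (n + 1) with h | h
  · rw [arr_faceFun i X f (by omega)]
    split_ifs <;> first | rfl | exact Mor.cod_comp _ _ | (exfalso; omega)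
  · obtain rfl : j = n + 1 := by omega
    rw [arr_last, arr_faceFun i X f (by omega), if_neg (show ¬ n + 1 ≤ i.val by omega), arr_last]
    split_ifs <;> first | rfl | exact Mor.cod_comp _ _ | (exfalso; omega)

/-- The factors `i` and `i + 1` that are multiplied both precede the inserted one, so the face only
lowers the place of insertion. -/
theorem CN.face_ins_of_lt (x : ∀ X : D, X ⟶ X) {n : ℕ} (i : Fin (n + 2)) (p : Fin (n + 3))
    (i' : Fin (n + 1)) (p' : Fin (n + 2)) (hi : i.val = i'.val) (hp : p.val = p'.val + 1)
    (h : i.val + 1 < p.val) (c : CN k D (n + 1)) :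
    CN.face i (CN.ins k x p c) = CN.ins k x p' (CN.face i' c) := by
  suffices h : CN.face i ∘ₗ CN.ins k x p = CN.ins (D := D) k x p' ∘ₗ CN.face i' from
    LinearMap.congr_fun h c
  refine CN.hom_ext fun X f => ?_
  simp only [LinearMap.comp_apply, CN.ins_gen, CN.face_gen]
  refine CN.gen_congr fun j hj => ?_
  have h1 := fun j hj => arr_faceFun i _ (insFun k x p X f) (j := j) hj
  have h2 := fun j hj => arr_insFun k x p X f (j := j) hj
  have h3 := fun j hj => arr_faceFun i' X f (j := j) hj
  have h3' := fun j hj => arr_faceFun_cod i' X f (j := j) hj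
  have h4 := fun j hj => arr_insFun k x p' _ (faceFun i' X f) (j := j) hj
  generalize arr (faceFun i _ (insFun k x p X f)) = A at *
  generalize arr (insFun k x p X f) = B at *
  generalize arr (insFun k x p' _ (faceFun i' X f)) = A' at *
  generalize arr (faceFun i' X f) = B' at *
  generalize arr f = F at *
  have := p.isLt
  -- The families are now opaque sequences subject to case formulas. Only these indices occur, and
  -- the identity becomes a case analysis on the order of `i`, `j` and `p`.
  have a1 := h1 j hj
  have a2 := h2 j
  have a3 := h2 (j + 1)
  have a4 := h4 j
  have a5 := h3 j
  have a6 := h3 (j - 1)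
  have a7 := h3' j
  clear h1 h2 h3 h3' h4
  rcases j with _ | j <;> grind (splits := 30)

/-- Both multiplied factors come after the inserted one, so here the face index drops and the place
of insertion stays. -/
theorem CN.face_ins_of_gt (x : ∀ X : D, X ⟶ X) {n : ℕ} (i : Fin (n + 2)) (p : Fin (n + 3))
    (i' : Fin (n + 1)) (p' : Fin (n + 2)) (hi : i.val = i'.val + 1) (hp : p.val = p'.val)
    (h : p.val < i.val) (c : CN k D (n + 1)) :
    CN.face i (CN.ins k x p c) = CN.ins k x p' (CN.face i' c) := by
  suffices h : CN.face i ∘ₗ CN.ins k x p = CN.ins (D := D) k x p' ∘ₗ CN.face i' from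
    LinearMap.congr_fun h c
  refine CN.hom_ext fun X f => ?_
  simp only [LinearMap.comp_apply, CN.ins_gen, CN.face_gen]
  refine CN.gen_congr fun j hj => ?_
  have h1 := fun j hj => arr_faceFun i _ (insFun k x p X f) (j := j) hj
  have h2 := fun j hj => arr_insFun k x p X f (j := j) hj
  have h3 := fun j hj => arr_faceFun i' X f (j := j) hj
  have h3' := fun j hj => arr_faceFun_cod i' X f (j := j) hj
  have h4 := fun j hj => arr_insFun k x p' _ (faceFun i' X f) (j := j) hj
  generalize arr (faceFun i _ (insFun k x p X f)) = A at *
  generalize arr (insFun k x p X f) = B at *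
  generalize arr (insFun k x p' _ (faceFun i' X f)) = A' at *
  generalize arr (faceFun i' X f) = B' at *
  generalize arr f = F at *
  have := i.isLt
  have a1 := h1 j hj
  have a2 := h2 j
  have a3 := h2 (j + 1)
  have a4 := h4 j
  have a5 := h3 j
  have a6 := h3 (j - 1)
  have a7 := h3' j
  clear h1 h2 h3 h3' h4
  rcases j with _ | j <;> grind (splits := 30)

/-- Composition with `x` on the left: `f ↦ x ∘ f`. -/
def postComp (x : ∀ X : D, X ⟶ X) (X Y : D) : (X ⟶ Y) →ₗ[k] (X ⟶ Y) :=
  Linear.rightComp k X (x Y)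

/-- Composition with `x` on the right: `f ↦ f ∘ x`. -/
def preComp (x : ∀ X : D, X ⟶ X) (X Y : D) : (X ⟶ Y) →ₗ[k] (X ⟶ Y) :=
  Linear.leftComp k Y (x X)

theorem comp_postComp (x : ∀ X : D, X ⟶ X) (a : Mor D) :
    Mor.comp (Mor.of (x a.cod)) a = Mor.app (fun X Y => postComp k x X Y) a :=
  Mor.comp_of _ _

theorem comp_preComp (x : ∀ X : D, X ⟶ X) (a : Mor D) :
    Mor.comp a (Mor.of (x a.dom)) = Mor.app (fun X Y => preComp k x X Y) a :=
  Mor.comp_of _ _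

/-- The multiplied pair is `(x, fⁱ)`; in `face_ins_add_one` it is `(fⁱ, x)`. Faces of these two
kinds are what survives in the homotopy formula. -/
theorem CN.face_ins_self (x : ∀ X : D, X ⟶ X) {n : ℕ} (i : Fin (n + 1)) (p : Fin (n + 2))
    (h : p.val = i.val) (c : CN k D n) :
    CN.face i (CN.ins k x p c) = CN.slot k (postComp k x) i c := by
  suffices h : CN.face i ∘ₗ CN.ins k x p = CN.slot (D := D) k (postComp k x) i from
    LinearMap.congr_fun h c
  refine CN.hom_ext fun X f => ?_
  simp only [LinearMap.comp_apply, CN.ins_gen, CN.face_gen, CN.slot_gen]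
  refine CN.gen_congr fun j hj => ?_
  rw [arr_slot _ _ _ _ _ hj, arr_faceFun _ _ _ hj, arr_insFun _ _ _ _ _ (by omega),
    arr_insFun _ _ _ _ _ (by omega)]
  have := comp_postComp k x (arr f j)
  grind

theorem CN.face_ins_add_one (x : ∀ X : D, X ⟶ X) {n : ℕ} (i : Fin (n + 1)) (p : Fin (n + 2))
    (h : p.val = i.val + 1) (c : CN k D n) :
    CN.face i (CN.ins k x p c) = CN.slot k (preComp k x) i c := by
  suffices h : CN.face i ∘ₗ CN.ins k x p = CN.slot (D := D) k (preComp k x) i from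
    LinearMap.congr_fun h c
  refine CN.hom_ext fun X f => ?_
  simp only [LinearMap.comp_apply, CN.ins_gen, CN.face_gen, CN.slot_gen]
  refine CN.gen_congr fun j hj => ?_
  rw [arr_slot _ _ _ _ _ hj, arr_faceFun _ _ _ hj, arr_insFun _ _ _ _ _ (by omega),
    arr_insFun _ _ _ _ _ (by omega)]
  have := comp_preComp k x (arr f j)
  have := arr_dom f j
  grind

end InsertionRelations

/-! ### Insertions and the twisted rotation. -/

section InsertionRotation

variable (k : Type uk) {H : Type uH} {D : Type uD} [Field k] [Ring H] [HopfAlgebra k H]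
  [Category.{vD} D] [Preadditive D] [Linear k D] [HCategory k H D]

theorem arr_twistedRot (a : H) {n : ℕ} (X : Fin (n + 1) → D)
    (f : ∀ l : Fin (n + 1), X (l + 1) ⟶ X l) {j : ℕ} (hj : j ≤ n) :
    arr (Function.update (rotFun X f) 0 (a • rotFun X f 0)) j =
      if j = 0 then Mor.app (fun X Y u => (a • u : X ⟶ Y)) (arr f n) else arr f (j - 1) := by
  rw [arr_update_zero _ _ hj]
  rcases j with _ | j
  · rw [if_pos rfl, if_pos rfl, ← arr_rotFun_zero]; rfl
  · rw [if_neg (by omega), if_neg (by omega), arr_rotFun]; rfl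

/-- The existence of `p'` means that `p` is not the last place. The factor moved to the front and
acted on is then `fⁿ`, and the inserted one is merely shifted. -/
theorem CN.twistedRot_ins (x : ∀ X : D, X ⟶ X) (a : H) {n : ℕ} (p p' : Fin (n + 2))
    (hp : p'.val = p.val + 1) (c : CN k D n) :
    CN.twistedRot k a (CN.ins k x p c) = CN.ins k x p' (CN.twistedRot k a c) := by
  suffices h : CN.twistedRot k a ∘ₗ CN.ins k x p =
      CN.ins (D := D) k x p' ∘ₗ CN.twistedRot k a from LinearMap.congr_fun h c
  refine CN.hom_ext fun X f => ?_
  simp only [LinearMap.comp_apply, CN.ins_gen, CN.twistedRot_gen]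
  refine CN.gen_congr fun j hj => ?_
  have h1 := fun j hj => arr_twistedRot k a _ (insFun k x p X f) (j := j) hj
  have h2 := fun j hj => arr_insFun k x p X f (j := j) hj
  have h3 := fun j hj => arr_twistedRot k a X f (j := j) hj
  have h4 := fun j hj => arr_insFun k x p' _
    (Function.update (rotFun X f) 0 (a • rotFun X f 0)) (j := j) hj
  have h5 := arr_last (Function.update (rotFun X f) 0 (a • rotFun X f 0))
  generalize arr (insFun k x p X f) = B at *
  generalize arr (Function.update (rotFun X f) 0 (a • rotFun X f 0)) = A' at *
  have h7 := h1 j hj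
  have h8 := h4 j hj
  rw [h7, h8]
  clear h1 h4 h7 h8
  have h7 : ∀ u : Mor D, (u.app (fun X Y v => (a • v : X ⟶ Y))).cod = u.cod := fun _ => rfl
  generalize arr f = F at *
  have := p'.isLt
  grind

/-- Here `x` itself is moved to the front and acted on by `a`, which is a scalar by invariance. -/
theorem CN.twistedRot_ins_last (x : ∀ X : D, X ⟶ X)
    (hx : ∀ (h : H) (X : D), h • x X = Coalgebra.counit (R := k) h • x X) (a : H) {n : ℕ}
    (c : CN k D n) :
    CN.twistedRot k a (CN.ins k x (Fin.last _) c) =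
      Coalgebra.counit (R := k) a • CN.ins k x 0 c := by
  -- The scalar is absorbed into the inserted family, so that both sides are generators and can be
  -- compared factor by factor.
  suffices h : CN.twistedRot k a ∘ₗ CN.ins k x (Fin.last _) =
      CN.ins (D := D) (n := n) k (fun X => Coalgebra.counit (R := k) a • x X) 0 by
    rw [← LinearMap.smul_apply, ← CN.ins_smul, ← h]; rfl
  refine CN.hom_ext fun X f => ?_
  simp only [LinearMap.comp_apply, CN.ins_gen, CN.twistedRot_gen]
  refine CN.gen_congr fun j hj => ?_
  rw [arr_twistedRot k a _ _ hj, arr_insFun _ _ _ _ _ hj, arr_insFun _ _ _ _ _ le_rfl,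
    arr_insFun _ _ _ _ _ (by omega), arr_last]
  rcases j with _ | j
  · rw [if_pos rfl, if_neg (by simp), if_pos (by simp), if_neg (by simp), if_pos (by simp)]
    simp [Mor.app, hx]
  · simp; omega

end InsertionRotation

/-! ## Iterated coproducts and the counit -/

section IterComul

variable (k : Type uk) (H : Type uH) [Field k] [Ring H] [HopfAlgebra k H]

theorem consTensor_tprod {n : ℕ} (h : H) (t : Fin (n + 1) → H) :
    consTensor k H n h (PiTensorProduct.tprod k t) =
      PiTensorProduct.tprod k (Fin.cons h t : Fin (n + 2) → H) := by
  simp only [consTensor, LinearMap.comp_apply, LinearEquiv.coe_coe, PiTensorProduct.lift.tprod]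
  rfl

/-- Application of the counit to the `p`-th factor of `H^{⊗(n+2)}`. -/
def counitAt {n : ℕ} (p : Fin (n + 2)) :
    (⨂[k] _ : Fin (n + 2), H) →ₗ[k] (⨂[k] _ : Fin (n + 1), H) :=
  PiTensorProduct.lift (LinearMap.uncurryMid p
    ((Coalgebra.counit (R := k) (A := H)).smulRight
      (PiTensorProduct.tprod k (s := fun _ : Fin (n + 1) => H))))

theorem counitAt_tprod {n : ℕ} (p : Fin (n + 2)) (t : Fin (n + 2) → H) :
    counitAt k H p (PiTensorProduct.tprod k t) =
      Coalgebra.counit (R := k) (t p) •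
        PiTensorProduct.tprod k (fun q => t (p.succAbove q)) := by
  simp only [counitAt, PiTensorProduct.lift.tprod]
  rfl

theorem counitAt_zero_consTensor {n : ℕ} (h : H) (z : ⨂[k] _ : Fin (n + 1), H) :
    counitAt k H 0 (consTensor k H n h z) = Coalgebra.counit (R := k) h • z := by
  induction z using PiTensorProduct.induction_on with
  | smul_tprod r t =>
    simp only [map_smul, consTensor_tprod, counitAt_tprod, Fin.cons_zero, Fin.zero_succAbove,
      Fin.cons_succ]
    rw [smul_comm]
  | add x y hx hy => simp only [map_add, hx, hy, smul_add]

theorem counitAt_succ_consTensor {n : ℕ} (p : Fin (n + 2)) (h : H)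
    (z : ⨂[k] _ : Fin (n + 2), H) :
    counitAt k H p.succ (consTensor k H (n + 1) h z) = consTensor k H n h (counitAt k H p z) := by
  induction z using PiTensorProduct.induction_on with
  | smul_tprod r t =>
    simp only [map_smul, consTensor_tprod, counitAt_tprod, Fin.cons_succ]
    congr 3
    funext q
    refine Fin.cases ?_ (fun q => ?_) q
    · simp
    · simp
  | add x y hx hy => simp only [map_add, hx, hy]

theorem iterComul_succ_repr {n : ℕ} (h : H) {ι : Type*} (R : Coalgebra.Repr k h ι) :
    iterComul k H (n + 1) h =
      ∑ i ∈ R.index, consTensor k H n (R.left i) (iterComul k H n (R.right i)) := by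
  simp only [iterComul, LinearMap.comp_apply, ← R.eq, map_sum, TensorProduct.lift.tmul,
    LinearMap.compl₂_apply]

/-- The recursion splits off the first leg. Place `0` is the left counit law, and a later place
passes to the remaining legs by induction. The right counit law enters only for the second of two
legs, in the base case. -/
theorem counitAt_iterComul {n : ℕ} (p : Fin (n + 2)) (h : H) :
    counitAt k H p (iterComul k H (n + 1) h) = iterComul k H n h := by
  induction n generalizing h with
  | zero =>
    let R := Coalgebra.Repr.arbitrary k h
    rw [iterComul_succ_repr k H h R, map_sum]
    refine Fin.cases ?_ (fun p => ?_) p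
    · simp only [counitAt_zero_consTensor, ← map_smul, ← map_sum]
      rw [Coalgebra.sum_counit_smul]
    · obtain rfl : p = 0 := Subsingleton.elim (α := Fin 1) _ _
      have e : ∀ a : H, iterComul k H 0 a = PiTensorProduct.tprod k (fun _ : Fin 1 => a) :=
        fun a => PiTensorProduct.subsingletonEquiv_symm_apply' _ _
      have e' : ∀ a b : H, counitAt k H (1 : Fin 2) (consTensor k H 0 a (iterComul k H 0 b)) =
          iterComul k H 0 (Coalgebra.counit (R := k) b • a) := by
        intro a b
        rw [map_smul, e, e, consTensor_tprod, counitAt_tprod]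
        congr 2
        funext q
        obtain rfl : q = 0 := Subsingleton.elim (α := Fin 1) _ _
        rfl
      simp only [Fin.succ_zero_eq_one, e', ← map_sum]
      congr 1
      have := congrArg (TensorProduct.rid k H) (Coalgebra.sum_tmul_counit_eq (R := k) (repr := R))
      simpa only [map_sum, TensorProduct.rid_tmul, one_smul] using this
  | succ n ih =>
    let R := Coalgebra.Repr.arbitrary k h
    rw [iterComul_succ_repr k H h R, map_sum]
    refine Fin.cases ?_ (fun p => ?_) p
    · simp only [counitAt_zero_consTensor, ← map_smul, ← map_sum]
      rw [Coalgebra.sum_counit_smul]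
    · simp only [counitAt_succ_consTensor, ih]
      rw [iterComul_succ_repr k H h R]

end IterComul

/-! ## The diagonal action -/

section Act

variable (k : Type uk) {H : Type uH} {D : Type uD} [Field k] [Ring H] [HopfAlgebra k H]
  [Category.{vD} D] [Preadditive D] [Linear k D] [HCategory k H D]

/-- The action of `H^{⊗(n+1)}` on `f⁰ ⊗ ⋯ ⊗ fⁿ`. -/
def CN.actTensor {n : ℕ} (X : Fin (n + 1) → D) (f : ∀ l : Fin (n + 1), X (l + 1) ⟶ X l) :
    (⨂[k] _ : Fin (n + 1), H) →ₗ[k] CN k D n :=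
  CN.incl X ∘ₗ (PiTensorProduct.map₂
    (fun i : Fin (n + 1) => homAct k (H := H) (X (i + 1)) (X i))).flip (PiTensorProduct.tprod k f)

theorem CN.actTensor_tprod {n : ℕ} (X : Fin (n + 1) → D)
    (f : ∀ l : Fin (n + 1), X (l + 1) ⟶ X l) (t : Fin (n + 1) → H) :
    CN.actTensor k X f (PiTensorProduct.tprod k t) = CN.gen k X (fun l => t l • f l) := by
  simp only [CN.actTensor, LinearMap.comp_apply, LinearMap.flip_apply,
    PiTensorProduct.map₂_tprod_tprod]
  rfl

theorem CN.act_gen {n : ℕ} (h : H) (X : Fin (n + 1) → D)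
    (f : ∀ l : Fin (n + 1), X (l + 1) ⟶ X l) :
    CN.act k h (CN.gen k X f) = CN.actTensor k X f (iterComul k H n h) := by
  simp only [CN.act, LinearMap.flip_apply, CN.desc_gen]
  rfl

theorem hsmul_castHom {X X' Y Y' : D} (e : X = X') (e' : Y = Y') (h : H) (f : X ⟶ Y) :
    h • castHom k e e' f = castHom k e e' (h • f) := by
  subst e e'
  simp [castHom_apply]

/-- On the inserted invariant factor the corresponding leg of the iterated coproduct acts by its
counit, and `counitAt_iterComul` removes that leg. -/
theorem CN.ins_act (x : ∀ X : D, X ⟶ X)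
    (hx : ∀ (h : H) (X : D), h • x X = Coalgebra.counit (R := k) h • x X) {n : ℕ}
    (p : Fin (n + 2)) (h : H) (c : CN k D n) :
    CN.ins k x p (CN.act k h c) = CN.act k h (CN.ins k x p c) := by
  suffices e : CN.ins k x p ∘ₗ CN.act (D := D) k h = CN.act k h ∘ₗ CN.ins k x p from
    LinearMap.congr_fun e c
  refine CN.hom_ext fun X f => ?_
  simp only [LinearMap.comp_apply, CN.ins_gen, CN.act_gen]
  rw [← counitAt_iterComul k H p h]
  suffices e : CN.ins k x p ∘ₗ CN.actTensor k X f ∘ₗ counitAt k H p =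
      CN.actTensor k (insObj p X) (insFun k x p X f) from LinearMap.congr_fun e _
  refine PiTensorProduct.ext (MultilinearMap.ext fun t => ?_)
  simp only [LinearMap.compMultilinearMap_apply, LinearMap.comp_apply, counitAt_tprod, map_smul,
    CN.actTensor_tprod, CN.ins_gen]
  rw [← CN.ins_gen, ← LinearMap.smul_apply, ← CN.ins_smul, CN.ins_gen]
  congr 1
  funext j
  cases j using Fin.succAboveCases p with
  | x =>
    unfold insFun
    rw [Fin.insertNth_apply_same, Fin.insertNth_apply_same, hsmul_castHom, hx]
  | p q =>
    unfold insFun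
    rw [Fin.insertNth_apply_succAbove, Fin.insertNth_apply_succAbove, hsmul_castHom]

end Act

/-! ## Maps of cyclic nerves -/

section NerveMap

variable (k : Type uk) (H : Type uH) (D : Type uD) (C : Type uC)
  [Field k] [Ring H] [HopfAlgebra k H]
  [Category.{vD} D] [Preadditive D] [Linear k D] [HCategory k H D]
  [Category.{vC} C] [Preadditive C] [Linear k C] [HCategory k H C]

/-- A family of linear maps between the cyclic nerves compatible with faces, twisted rotations and
the diagonal action. -/
structure NerveMap where
  app : ∀ n : ℕ, CN k D n →ₗ[k] CN k C n
  app_face : ∀ {n : ℕ} (i : Fin (n + 1)) (c : CN k D (n + 1)),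
    app n (CN.face i c) = CN.face i (app (n + 1) c)
  app_twistedRot : ∀ {n : ℕ} (a : H) (c : CN k D n),
    app n (CN.twistedRot k a c) = CN.twistedRot k a (app n c)
  app_act : ∀ {n : ℕ} (a : H) (c : CN k D n), app n (CN.act k a c) = CN.act k a (app n c)

/-- An `H`-linear semifunctor, between left `H`-categories in arbitrary universes. -/
structure Semifunctor where
  obj : D → C
  map : ∀ {X Y : D}, (X ⟶ Y) →ₗ[k] (obj X ⟶ obj Y)
  map_comp : ∀ {X Y Z : D} (f : X ⟶ Y) (g : Y ⟶ Z), map (f ≫ g) = map f ≫ map g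
  map_hsmul : ∀ {X Y : D} (h : H) (f : X ⟶ Y), map (h • f) = h • map f

variable {k H D C}

namespace Semifunctor

variable (F : Semifunctor k H D C)

/-- The action of a semifunctor on total morphisms. -/
def mapMor (a : Mor D) : Mor C := Mor.of (F.map a.hom)

theorem mapMor_comp {a b : Mor D} (h : b.cod = a.dom) :
    F.mapMor (a.comp b) = (F.mapMor a).comp (F.mapMor b) := by
  obtain ⟨X, Y, f⟩ := a
  obtain ⟨Z, W, g⟩ := b
  obtain rfl : W = X := h
  change F.mapMor ((Mor.of f).comp (Mor.of g)) = (Mor.of (F.map f)).comp (Mor.of (F.map g))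
  rw [Mor.comp_of, Mor.comp_of, ← F.map_comp]
  rfl

theorem arr_map {n : ℕ} (X : Fin (n + 1) → D) (f : ∀ l : Fin (n + 1), X (l + 1) ⟶ X l) (j : ℕ) :
    arr (X := fun l => F.obj (X l)) (fun l => F.map (f l)) j = F.mapMor (arr f j) := rfl

/-- The map induced by a semifunctor in one degree of the cyclic nerve. -/
def nerveApp (n : ℕ) : CN k D n →ₗ[k] CN k C n :=
  CN.desc fun X => CN.incl (fun l => F.obj (X l)) ∘ₗ
    PiTensorProduct.map (fun _ : Fin (n + 1) => F.map)

theorem nerveApp_gen {n : ℕ} (X : Fin (n + 1) → D) (f : ∀ l : Fin (n + 1), X (l + 1) ⟶ X l) :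
    F.nerveApp n (CN.gen k X f) = CN.gen k (fun l => F.obj (X l)) (fun l => F.map (f l)) := by
  simp only [nerveApp, CN.desc_gen, LinearMap.comp_apply, PiTensorProduct.map_tprod]
  rfl

/-- The map of cyclic nerves induced by a semifunctor. -/
def nerve : NerveMap k H D C where
  app := F.nerveApp
  app_face {n} i c := by
    suffices e : F.nerveApp n ∘ₗ CN.face i = CN.face i ∘ₗ F.nerveApp (n + 1) from
      LinearMap.congr_fun e c
    refine CN.hom_ext fun X f => ?_
    simp only [LinearMap.comp_apply, CN.face_gen, nerveApp_gen]
    refine CN.gen_congr fun j hj => ?_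
    rw [arr_map, arr_faceFun _ _ _ hj, arr_faceFun _ _ _ hj, arr_map, arr_map]
    have := F.mapMor_comp (arr_dom f j).symm
    split_ifs <;> first | rfl | assumption
  app_twistedRot {n} a c := by
    suffices e : F.nerveApp n ∘ₗ CN.twistedRot k a = CN.twistedRot k a ∘ₗ F.nerveApp n from
      LinearMap.congr_fun e c
    refine CN.hom_ext fun X f => ?_
    simp only [LinearMap.comp_apply, CN.twistedRot_gen, nerveApp_gen]
    refine CN.gen_congr fun j hj => ?_
    rw [arr_map, arr_twistedRot _ _ _ _ hj, arr_twistedRot _ _ _ _ hj, arr_map, arr_map]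
    split_ifs
    · exact congrArg (fun u => Mor.of u) (F.map_hsmul a (arr f n).hom)
    · rfl
  app_act {n} a c := by
    suffices e : F.nerveApp n ∘ₗ CN.act k a = CN.act k a ∘ₗ F.nerveApp n from
      LinearMap.congr_fun e c
    refine CN.hom_ext fun X f => ?_
    simp only [LinearMap.comp_apply, CN.act_gen, nerveApp_gen]
    suffices e : F.nerveApp n ∘ₗ CN.actTensor k X f =
        CN.actTensor k (fun l => F.obj (X l)) (fun l => F.map (f l)) from
      LinearMap.congr_fun e _
    refine PiTensorProduct.ext (MultilinearMap.ext fun t => ?_)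
    simp only [LinearMap.compMultilinearMap_apply, LinearMap.comp_apply, CN.actTensor_tprod,
      nerveApp_gen, F.map_hsmul]

end Semifunctor

end NerveMap

/-! ## The effect on Hopf-cyclic cochains -/

section ChainLevel

variable {k : Type uk} {H : Type uH} {D : Type uD} {C : Type uC} {M : Type uM}
  [Field k] [Ring H] [HopfAlgebra k H]
  [Category.{vD} D] [Preadditive D] [Linear k D] [HCategory k H D]
  [Category.{vC} C] [Preadditive C] [Linear k C] [HCategory k H C]
  [AddCommGroup M] [Module k M]

theorem chainFace_lTensor {n n' : ℕ} (i : Fin (n + 1)) (i' : Fin (n' + 1))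
    {Q : CN k D (n + 1) →ₗ[k] CN k C (n' + 1)} {Q' : CN k D n →ₗ[k] CN k C n'}
    (h : ∀ c, CN.face i' (Q c) = Q' (CN.face i c)) (w : Chain k D M (n + 1)) :
    chainFace k M i' (LinearMap.lTensor M Q w) = LinearMap.lTensor M Q' (chainFace k M i w) := by
  simp only [chainFace, ← LinearMap.comp_apply, ← LinearMap.lTensor_comp]
  congr 2
  exact LinearMap.ext h

theorem chainFace_lTensor_eq {n n' : ℕ} (i' : Fin (n' + 1))
    {Q : CN k D n →ₗ[k] CN k C (n' + 1)} {Q' : CN k D n →ₗ[k] CN k C n'}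
    (h : ∀ c, CN.face i' (Q c) = Q' c) (w : Chain k D M n) :
    chainFace k M i' (LinearMap.lTensor M Q w) = LinearMap.lTensor M Q' w := by
  simp only [chainFace, ← LinearMap.comp_apply, ← LinearMap.lTensor_comp]
  congr 2
  exact LinearMap.ext h

theorem lTensor_sum_smul {V W : Type*} [AddCommGroup V] [Module k V] [AddCommGroup W] [Module k W]
    {ι : Type*} (s : Finset ι) (r : ι → k) (F : ι → V →ₗ[k] W) (w : M ⊗[k] V) :
    LinearMap.lTensor M (∑ i ∈ s, r i • F i) w = ∑ i ∈ s, r i • LinearMap.lTensor M (F i) w := by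
  change LinearMap.lTensorHom M _ w = _
  simp only [map_sum, map_smul, LinearMap.sum_apply, LinearMap.smul_apply]
  rfl

variable [Module Hᵐᵒᵖ M] [IsScalarTower k Hᵐᵒᵖ M]

theorem chainRightAct_lTensor {n n' : ℕ} {Q : CN k D n →ₗ[k] CN k C n'}
    (h : ∀ (a : H) c, Q (CN.act k a c) = CN.act k a (Q c)) (a : H) (w : Chain k D M n) :
    LinearMap.lTensor M Q (chainRightAct k H D M n a w) =
      chainRightAct k H C M n' a (LinearMap.lTensor M Q w) := by
  simp only [chainRightAct, LinearMap.comp_apply]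
  generalize Coalgebra.comul (R := k) a = z
  induction z using TensorProduct.induction_on with
  | zero => simp
  | add z z' hz hz' => simp only [map_add, LinearMap.add_apply, hz, hz']
  | tmul p q =>
    induction w using TensorProduct.induction_on with
    | zero => simp
    | add w w' hw hw' => simp only [map_add, hw, hw']
    | tmul m c =>
      simp only [TensorProduct.lift.tmul, LinearMap.compl₁₂_apply,
        TensorProduct.mapBilinear_apply, TensorProduct.map_tmul, LinearMap.lTensor_tmul,
        LinearMap.comp_apply, h]

variable [SAYDModule k H M] [BijectiveAntipode k H]

theorem counit_antipodeInv (a : H) :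
    Coalgebra.counit (R := k) (antipodeInv k H a) = Coalgebra.counit (R := k) a := by
  obtain ⟨a, rfl⟩ := (BijectiveAntipode.bijective (k := k) (H := H)).surjective a
  rw [HopfAlgebra.counit_antipode]
  congr 1
  exact LinearEquiv.symm_apply_apply (LinearEquiv.ofBijective (HopfAlgebra.antipode k (A := H))
    BijectiveAntipode.bijective) a

/-- `Q` and `Q'` may differ because rotation changes the place of an insertion. -/
theorem chainT_lTensor {n n' : ℕ} {Q Q' : CN k D n →ₗ[k] CN k C n'}
    (h : ∀ (a : H) c, CN.twistedRot k a (Q c) = Q' (CN.twistedRot k a c)) (w : Chain k D M n) :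
    chainT k H C M n' (LinearMap.lTensor M Q w) =
      LinearMap.lTensor M Q' (chainT k H D M n w) := by
  induction w using TensorProduct.induction_on with
  | zero => simp
  | add w w' hw hw' => simp only [map_add, hw, hw']
  | tmul m c =>
    simp only [chainT, LinearMap.comp_apply, LinearMap.rTensor_tmul, LinearMap.lTensor_tmul]
    generalize SAYDModule.coaction (k := k) (H := H) m = z
    induction z using TensorProduct.induction_on with
    | zero => simp
    | add z z' hz hz' => simp only [map_add, TensorProduct.add_tmul, hz, hz']
    | tmul a m =>
      simp [h]

/-- The twist collapses: `ε(S⁻¹(m₍₋₁₎)) m₍₀₎ = m`, by `counit_antipodeInv` and the counit law of the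
coaction. -/
theorem chainT_lTensor_counit {n n' : ℕ} {Q Q' : CN k D n →ₗ[k] CN k C n'}
    (h : ∀ (a : H) c, CN.twistedRot k a (Q c) = Coalgebra.counit (R := k) a • Q' c)
    (w : Chain k D M n) :
    chainT k H C M n' (LinearMap.lTensor M Q w) = LinearMap.lTensor M Q' w := by
  induction w using TensorProduct.induction_on with
  | zero => simp
  | add w w' hw hw' => simp only [map_add, hw, hw']
  | tmul m c =>
    rw [LinearMap.lTensor_tmul, LinearMap.lTensor_tmul]
    conv_rhs => rw [← SAYDModule.counit_coaction (k := k) (H := H) m]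
    simp only [chainT, LinearMap.comp_apply, LinearMap.rTensor_tmul]
    generalize SAYDModule.coaction (k := k) (H := H) m = z
    induction z using TensorProduct.induction_on with
    | zero => simp
    | add z z' hz hz' => simp only [map_add, TensorProduct.add_tmul, hz, hz']
    | tmul a m =>
      simp [h, counit_antipodeInv, TensorProduct.smul_tmul']

variable (k H D M) in
/-- The Hochschild boundary on chains. -/
def boundary (n : ℕ) : Chain k D M (n + 1) →ₗ[k] Chain k D M n :=
  ∑ i : Fin (n + 1), (-1 : k) ^ (i : ℕ) • chainFace k M i +
    (-1 : k) ^ (n + 1) • chainLastFace k H D M n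

theorem hochschildB_apply {n : ℕ} (φ : Cochain k D M n) (w : Chain k D M (n + 1)) :
    hochschildB k H D M n φ w = φ (boundary k H D M n w) := by
  simp [hochschildB, boundary, LinearMap.sum_apply]

theorem mem_cyclicCochain {n : ℕ} (φ : Cochain k D M n) :
    φ ∈ CyclicCochain k H D M n ↔ φ ∈ HCochain k H D M n ∧
      ∀ w, φ (chainT k H D M n w) = (-1) ^ n * φ w := by
  rw [CyclicCochain, Submodule.mem_inf, LinearMap.mem_ker, LinearMap.ext_iff]
  refine and_congr_right fun _ => forall_congr' fun w => ?_
  have h1 : ((-1 : k) ^ n) * (-1) ^ n = 1 := by rw [← mul_pow]; simp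
  simp only [lam, tau, LinearMap.sub_apply, LinearMap.id_apply, LinearMap.smul_apply,
    LinearMap.lcomp_apply, LinearMap.zero_apply, smul_eq_mul]
  constructor
  · intro h
    rw [sub_eq_zero.mp h, ← mul_assoc, h1, one_mul]
  · intro h
    rw [h, ← mul_assoc, h1, one_mul, sub_self]

namespace NerveMap

variable (Q : NerveMap k H D C)

variable (M) in
/-- Pullback of cochains along a map of cyclic nerves. -/
def pull (n : ℕ) : Cochain k C M n →ₗ[k] Cochain k D M n :=
  (LinearMap.lTensor M (Q.app n)).lcomp k k

theorem pull_apply {n : ℕ} (φ : Cochain k C M n) (w : Chain k D M n) :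
    Q.pull M n φ w = φ (LinearMap.lTensor M (Q.app n) w) := rfl

theorem lTensor_boundary {n : ℕ} (w : Chain k D M (n + 1)) :
    LinearMap.lTensor M (Q.app n) (boundary k H D M n w) =
      boundary k H C M n (LinearMap.lTensor M (Q.app (n + 1)) w) := by
  simp only [boundary, chainLastFace, LinearMap.add_apply, LinearMap.sum_apply,
    LinearMap.smul_apply, LinearMap.comp_apply, map_add, map_sum, map_smul]
  rw [chainT_lTensor (Q' := Q.app (n + 1)) fun a c => (Q.app_twistedRot a c).symm]
  simp only [chainFace_lTensor _ _ fun c => (Q.app_face _ c).symm]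

theorem pull_hochschildB {n : ℕ} (φ : Cochain k C M n) :
    Q.pull M (n + 1) (hochschildB k H C M n φ) = hochschildB k H D M n (Q.pull M n φ) := by
  refine LinearMap.ext fun w => ?_
  rw [hochschildB_apply, pull_apply, pull_apply, hochschildB_apply, lTensor_boundary]

theorem pull_mem_cyclicCochain {n : ℕ} {φ : Cochain k C M n} (h : φ ∈ CyclicCochain k H C M n) :
    Q.pull M n φ ∈ CyclicCochain k H D M n := by
  rw [mem_cyclicCochain] at h ⊢
  refine ⟨fun a w => ?_, fun w => ?_⟩
  · rw [pull_apply, pull_apply, chainRightAct_lTensor fun a c => Q.app_act a c]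
    exact h.1 a _
  · rw [pull_apply, pull_apply, ← chainT_lTensor fun a c => (Q.app_twistedRot a c).symm]
    exact h.2 _

theorem pull_mem_cocycles {n : ℕ} {φ : Cochain k C M n} (h : φ ∈ Cocycles k H C M n) :
    Q.pull M n φ ∈ Cocycles k H D M n := by
  refine ⟨Q.pull_mem_cyclicCochain h.1, LinearMap.mem_ker.mpr ?_⟩
  rw [← pull_hochschildB, LinearMap.mem_ker.mp h.2, map_zero]

theorem pull_mem_coboundaries {n : ℕ} {φ : Cochain k C M n} (h : φ ∈ Coboundaries k H C M n) :
    Q.pull M n φ ∈ Coboundaries k H D M n := by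
  cases n with
  | zero =>
    obtain rfl : φ = 0 := h
    rw [map_zero]; exact Submodule.zero_mem _
  | succ n =>
    obtain ⟨ψ, hψ, rfl⟩ := h
    rw [pull_hochschildB]
    exact ⟨_, Q.pull_mem_cyclicCochain hψ, rfl⟩

end NerveMap

/-! ## Inner derivations act trivially -/

/-- Combinatorial core of the homotopy. In the application `a i l` is face `i` after insertion
behind factor `l`, and `c i l` is the same insertion after face `i`. Off the two diagonals, an index
shift by one changes the sign and gives minus the double sum of `c`. The diagonal `i = l` gives `R`,
and `i = l + 1` gives `-L`. The term `L 0` is absent, since it belongs to the cyclic last face. -/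
theorem alternating_double_sum {V : Type*} [AddCommGroup V] [Module k V] (n : ℕ)
    (a c : ℕ → ℕ → V) (R L : ℕ → V)
    (h1 : ∀ i l, i ≤ l → l + 1 ≤ n → a i (l + 1) = c i l)
    (h2 : ∀ l, l ≤ n → a l l = R l)
    (h3 : ∀ l, l + 1 ≤ n → a (l + 1) l = L (l + 1))
    (h4 : ∀ i l, l < i → i + 1 ≤ n → a (i + 1) l = c i l) :
    ∑ i ∈ Finset.range (n + 1), ∑ l ∈ Finset.range (n + 1), (-1 : k) ^ (i + l) • a i l =
      ∑ l ∈ Finset.range (n + 1), R l - ∑ l ∈ Finset.range n, L (l + 1) -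
        ∑ i ∈ Finset.range n, ∑ l ∈ Finset.range n, (-1 : k) ^ (i + l) • c i l := by
  induction n with
  | zero => simp [h2]
  | succ n ih =>
    have ih := ih (fun i l hil hl => h1 i l hil (by omega)) (fun l hl => h2 l (by omega))
      (fun l hl => h3 l (by omega)) (fun i l hil hl => h4 i l hil (by omega))
    have e1 : ∀ i ∈ Finset.range (n + 1),
        (-1 : k) ^ (i + (n + 1)) • a i (n + 1) = -((-1 : k) ^ (i + n) • c i n) := by
      intro i hi
      rw [h1 i n (by simpa [Nat.lt_succ_iff] using hi) le_rfl, ← add_assoc, pow_succ]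
      simp
    have e2 : ∀ l ∈ Finset.range n,
        (-1 : k) ^ (n + 1 + l) • a (n + 1) l = -((-1 : k) ^ (n + l) • c n l) := by
      intro l hl
      rw [h4 n l (by simpa using hl) le_rfl, add_right_comm, pow_succ]
      simp
    have e3 : (-1 : k) ^ (n + 1 + (n + 1)) • a (n + 1) (n + 1) = R (n + 1) := by
      rw [h2 _ le_rfl, ← two_mul, pow_mul]; simp
    have e4 : (-1 : k) ^ (n + 1 + n) • a (n + 1) n = - L (n + 1) := by
      rw [h3 _ le_rfl, add_right_comm, ← two_mul, pow_succ, pow_mul]; simp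
    have s1 : ∑ i ∈ Finset.range (n + 2), ∑ l ∈ Finset.range (n + 2), (-1 : k) ^ (i + l) • a i l =
        ∑ i ∈ Finset.range (n + 1), ∑ l ∈ Finset.range (n + 1), (-1 : k) ^ (i + l) • a i l +
        ∑ i ∈ Finset.range (n + 1), (-1 : k) ^ (i + (n + 1)) • a i (n + 1) +
        (∑ l ∈ Finset.range n, (-1 : k) ^ (n + 1 + l) • a (n + 1) l +
          (-1 : k) ^ (n + 1 + n) • a (n + 1) n +
          (-1 : k) ^ (n + 1 + (n + 1)) • a (n + 1) (n + 1)) := by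
      rw [Finset.sum_range_succ _ (n + 1)]
      simp only [Finset.sum_range_succ _ (n + 1), Finset.sum_add_distrib]
      rw [Finset.sum_range_succ (fun l => (-1 : k) ^ (n + 1 + l) • a (n + 1) l) n]
    have s2 : ∑ i ∈ Finset.range (n + 1), ∑ l ∈ Finset.range (n + 1), (-1 : k) ^ (i + l) • c i l =
        ∑ i ∈ Finset.range n, ∑ l ∈ Finset.range n, (-1 : k) ^ (i + l) • c i l +
        ∑ i ∈ Finset.range (n + 1), (-1 : k) ^ (i + n) • c i n +
        ∑ l ∈ Finset.range n, (-1 : k) ^ (n + l) • c n l := by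
      rw [Finset.sum_range_succ _ n]
      simp only [Finset.sum_range_succ _ n, Finset.sum_add_distrib]
      abel
    rw [s1, s2, ih, Finset.sum_congr rfl e1, Finset.sum_congr rfl e2, e3, e4,
      Finset.sum_range_succ R (n + 1), Finset.sum_range_succ (fun l => L (l + 1)) n,
      Finset.sum_neg_distrib,
      Finset.sum_neg_distrib]
    abel

variable (k) in
/-- The alternating sum of the insertions of `x` after each factor. -/
def CN.insAlt (x : ∀ X : D, X ⟶ X) (n : ℕ) : CN k D n →ₗ[k] CN k D (n + 1) :=
  ∑ l : Fin (n + 1), (-1 : k) ^ (l : ℕ) • CN.ins k x l.succ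

/-- Write `s_p` for insertion at place `p` and `t` for rotation. From `t s_p = s_{p+1} t` and `t
s_{n+1} = s_0`, rotation permutes the terms `φ s_1, …, φ s_{n+1}` cyclically up to sign. The sign
`(-1)^(n+1)` of `φ` and the index shift combine to `(-1)^n`. -/
theorem insAlt_mem_cyclicCochain (x : ∀ X : D, X ⟶ X)
    (hx : ∀ (h : H) (X : D), h • x X = Coalgebra.counit (R := k) h • x X) {n : ℕ}
    {φ : Cochain k D M (n + 1)} (hφ : φ ∈ CyclicCochain k H D M (n + 1)) :
    φ ∘ₗ LinearMap.lTensor M (CN.insAlt k x n) ∈ CyclicCochain k H D M n := by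
  rw [mem_cyclicCochain] at hφ ⊢
  refine ⟨fun a w => ?_, fun w => ?_⟩
  · rw [LinearMap.comp_apply, LinearMap.comp_apply, chainRightAct_lTensor]
    · exact hφ.1 a _
    · intro a c
      simp only [CN.insAlt, LinearMap.sum_apply, LinearMap.smul_apply, CN.ins_act k x hx, map_sum,
        map_smul]
  · have h1 : ∀ (p p' : Fin (n + 2)), p'.val = p.val + 1 →
        φ (LinearMap.lTensor M (CN.ins k x p') (chainT k H D M n w)) =
          (-1) ^ (n + 1) * φ (LinearMap.lTensor M (CN.ins k x p) w) := by
      intro p p' hp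
      rw [← hφ.2, chainT_lTensor fun a c => CN.twistedRot_ins k x a p p' hp c]
    have h2 : φ (LinearMap.lTensor M (CN.ins k x 0) w) =
        (-1) ^ (n + 1) * φ (LinearMap.lTensor M (CN.ins k x (Fin.last _)) w) := by
      rw [← hφ.2, chainT_lTensor_counit fun a c => CN.twistedRot_ins_last k x hx a c]
    have h3 : ∀ v : Chain k D M n, (φ ∘ₗ LinearMap.lTensor M (CN.insAlt k x n)) v =
        ∑ l : Fin (n + 1), (-1) ^ (l : ℕ) * φ (LinearMap.lTensor M (CN.ins k x l.succ) v) := by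
      intro v
      rw [LinearMap.comp_apply, CN.insAlt, lTensor_sum_smul, map_sum]
      simp only [map_smul, smul_eq_mul]
    rw [h3, h3]
    have h4 : ∀ l : Fin (n + 1),
        φ (LinearMap.lTensor M (CN.ins k x l.succ) (chainT k H D M n w)) =
          (-1) ^ (n + 1) * φ (LinearMap.lTensor M (CN.ins k x l.castSucc) w) :=
      fun l => h1 _ _ (by simp)
    simp only [h4]
    -- The left sum is split at its first term and the right one at its last. By `h2` the insertion
    -- at place `0` matches the one at the last place.
    rw [Fin.sum_univ_succ, Fin.sum_univ_castSucc]
    simp only [Fin.castSucc_zero, h2, Fin.val_zero, pow_zero, one_mul, Fin.val_last,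
      Fin.succ_last, Fin.val_succ, Fin.val_castSucc, Fin.succ_castSucc]
    rw [mul_add, Finset.mul_sum, add_comm]
    congr 1
    · refine Finset.sum_congr rfl fun l _ => ?_
      ring
    · simp only [pow_succ]
      ring

/-- Homotopy formula for the inner derivation given by `x`. The ordinary faces are treated by
`alternating_double_sum`. The last face commutes with all insertions but the one at the last place,
where it supplies the missing term at factor `0`. -/
theorem boundary_insAlt (x : ∀ X : D, X ⟶ X)
    (hx : ∀ (h : H) (X : D), h • x X = Coalgebra.counit (R := k) h • x X) {n : ℕ}
    (w : Chain k D M (n + 1)) :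
    boundary k H D M (n + 1) (LinearMap.lTensor M (CN.insAlt k x (n + 1)) w) +
      LinearMap.lTensor M (CN.insAlt k x n) (boundary k H D M n w) =
      ∑ l : Fin (n + 2), (LinearMap.lTensor M (CN.slot k (preComp k x) l) w -
        LinearMap.lTensor M (CN.slot k (postComp k x) l) w) := by
  -- Indices are natural numbers because `alternating_double_sum` is an induction over ranges;
  -- values outside the range never enter.
  let Kw : ℕ → Chain k D M (n + 2) := fun l =>
    LinearMap.lTensor M (CN.ins k x (Fin.ofNat (n + 3) (l + 1))) w
  let a : ℕ → ℕ → Chain k D M (n + 1) := fun i l => chainFace k M (Fin.ofNat (n + 2) i) (Kw l)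
  let c : ℕ → ℕ → Chain k D M (n + 1) := fun i l =>
    LinearMap.lTensor M (CN.ins k x (Fin.ofNat (n + 2) (l + 1)))
      (chainFace k M (Fin.ofNat (n + 1) i) w)
  let R : ℕ → Chain k D M (n + 1) := fun l =>
    LinearMap.lTensor M (CN.slot k (preComp k x) (Fin.ofNat (n + 2) l)) w
  let L : ℕ → Chain k D M (n + 1) := fun l =>
    LinearMap.lTensor M (CN.slot k (postComp k x) (Fin.ofNat (n + 2) l)) w
  let e : ℕ → Chain k D M (n + 1) := fun l =>
    LinearMap.lTensor M (CN.ins k x (Fin.ofNat (n + 2) (l + 1)))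
      (chainLastFace k H D M n w)
  have val : ∀ N j : ℕ, j < N + 1 → (Fin.ofNat (N + 1) j).val = j :=
    fun N j h => Nat.mod_eq_of_lt h
  have key := alternating_double_sum (k := k) (n + 1) a c R L
    (fun i l hil hl => chainFace_lTensor _ _ (fun c => CN.face_ins_of_lt k x _ _ _ _
      (by rw [val _ _ (by omega), val _ _ (by omega)])
      (by rw [val _ _ (by omega), val _ _ (by omega)])
      (by rw [val _ _ (by omega), val _ _ (by omega)]; omega) c) w)
    (fun l hl => chainFace_lTensor_eq _ (fun c => CN.face_ins_add_one k x _ _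
      (by rw [val _ _ (by omega), val _ _ (by omega)]) c) w)
    (fun l hl => chainFace_lTensor_eq _ (fun c => CN.face_ins_self k x _ _
      (by rw [val _ _ (by omega), val _ _ (by omega)]) c) w)
    (fun i l hil hl => chainFace_lTensor _ _ (fun c => CN.face_ins_of_gt k x _ _ _ _
      (by rw [val _ _ (by omega), val _ _ (by omega)])
      (by rw [val _ _ (by omega), val _ _ (by omega)])
      (by rw [val _ _ (by omega), val _ _ (by omega)]; omega) c) w)
  have hK : ∀ l : Fin (n + 2), LinearMap.lTensor M (CN.ins k x l.succ) w = Kw l := by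
    intro l
    have : l.succ = Fin.ofNat (n + 3) (l.val + 1) := by
      apply Fin.ext; rw [val _ _ (by omega), Fin.val_succ]
    rw [this]
  have hc : ∀ i l : Fin (n + 1), LinearMap.lTensor M (CN.ins k x l.succ) (chainFace k M i w) =
      c i l := by
    intro i l
    have : l.succ = Fin.ofNat (n + 2) (l.val + 1) := by
      apply Fin.ext; rw [val _ _ (by omega), Fin.val_succ]
    simp only [c, Fin.ofNat_val_eq_self, this]
  have he : ∀ l : Fin (n + 1), LinearMap.lTensor M (CN.ins k x l.succ)
      (chainLastFace k H D M n w) = e l := by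
    intro l
    have : l.succ = Fin.ofNat (n + 2) (l.val + 1) := by
      apply Fin.ext; rw [val _ _ (by omega), Fin.val_succ]
    simp only [e, this]
  have ha : ∀ i l : Fin (n + 2), chainFace k M i (Kw l) = a i l := by
    intro i l
    simp only [a, Fin.ofNat_val_eq_self]
  -- `d₀ t s_{l+1} = d₀ s_{l+2} t = s_{l+1} d₀ t`.
  have hlast : ∀ l : Fin (n + 1), chainLastFace k H D M (n + 1) (Kw l) = e l := by
    intro l
    have h1 : (Fin.ofNat (n + 3) (l.val + 2)).val = l.val + 2 := val _ _ (by omega)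
    have h2 : (Fin.ofNat (n + 3) (l.val + 1)).val = l.val + 1 := val _ _ (by omega)
    have h3 : (Fin.ofNat (n + 2) (l.val + 1)).val = l.val + 1 := val _ _ (by omega)
    simp only [chainLastFace, LinearMap.comp_apply, Kw, e]
    rw [chainT_lTensor fun b c => CN.twistedRot_ins k x b _ (Fin.ofNat (n + 3) (l.val + 2))
      (by rw [h1, h2]) c]
    exact chainFace_lTensor _ _ (fun c => CN.face_ins_of_lt k x _ _ _ _ rfl
      (by rw [h1, h3]) (by rw [h1]; simp) c) _
  -- `d₀ t s_{n+2} = d₀ s₀`, which composes factor `0` with `x` on the left.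
  have hlast' : chainLastFace k H D M (n + 1) (Kw (n + 1)) = L 0 := by
    have h1 : Fin.ofNat (n + 3) (n + 1 + 1) = Fin.last (n + 2) := by
      apply Fin.ext; rw [val _ _ (by omega)]; rfl
    simp only [chainLastFace, LinearMap.comp_apply, Kw, L, h1]
    rw [chainT_lTensor_counit fun b c => CN.twistedRot_ins_last k x hx b c]
    exact chainFace_lTensor_eq _ (fun c => CN.face_ins_self k x _ _ rfl c) _
  have hR : ∀ l : Fin (n + 2), LinearMap.lTensor M (CN.slot k (preComp k x) l) w = R l := by
    intro l; simp only [R, Fin.ofNat_val_eq_self]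
  have hL : ∀ l : Fin (n + 2), LinearMap.lTensor M (CN.slot k (postComp k x) l) w = L l := by
    intro l; simp only [L, Fin.ofNat_val_eq_self]
  rw [CN.insAlt, CN.insAlt, lTensor_sum_smul, lTensor_sum_smul]
  simp only [boundary, LinearMap.add_apply, LinearMap.sum_apply, LinearMap.smul_apply, map_add,
    map_sum, map_smul, hK, ha, hc, he, hR, hL]
  simp only [smul_add, Finset.sum_add_distrib, Finset.sum_sub_distrib]
  rw [Fin.sum_univ_eq_sum_range (fun l => R l) (n + 2),
    Fin.sum_univ_eq_sum_range (fun l => L l) (n + 2), Finset.sum_range_succ' L (n + 1)]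
  have swap : ∀ (N : ℕ) (u : ℕ → ℕ → Chain k D M (n + 1)),
      ∑ l : Fin N, (-1 : k) ^ (l : ℕ) • ∑ i : Fin N, (-1 : k) ^ (i : ℕ) • u i l =
      ∑ i ∈ Finset.range N, ∑ l ∈ Finset.range N, (-1 : k) ^ (i + l) • u i l := by
    intro N u
    rw [Finset.sum_comm, ← Fin.sum_univ_eq_sum_range
      (fun l => ∑ i ∈ Finset.range N, (-1 : k) ^ (i + l) • u i l) N]
    refine Finset.sum_congr rfl fun l _ => ?_
    rw [← Fin.sum_univ_eq_sum_range (fun i => (-1 : k) ^ (i + l.val) • u i l) N,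
      Finset.smul_sum]
    refine Finset.sum_congr rfl fun i _ => ?_
    rw [smul_smul, pow_add, mul_comm]
  have s3 : (-1 : k) ^ (n + 1) • (-1 : k) ^ (n + 1 + 1) • L 0 = - L 0 := by
    rw [smul_smul, ← pow_add, show n + 1 + (n + 1 + 1) = 2 * (n + 1) + 1 by ring, pow_succ, pow_mul]
    simp
  have s4 : ∑ l : Fin (n + 2), (-1 : k) ^ (l : ℕ) • (-1 : k) ^ (n + 1 + 1) •
      chainLastFace k H D M (n + 1) (Kw l) =
      - ∑ l : Fin (n + 1), (-1 : k) ^ (l : ℕ) • (-1 : k) ^ (n + 1) • e l - L 0 := by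
    rw [Fin.sum_univ_castSucc, Fin.val_last, hlast', s3, sub_eq_add_neg, ← Finset.sum_neg_distrib]
    congr 1
    refine Finset.sum_congr rfl fun l _ => ?_
    rw [Fin.val_castSucc, hlast, pow_succ (-1 : k) (n + 1)]
    simp
  rw [swap, swap, key, s4]
  abel

theorem boundary_insAlt_zero (x : ∀ X : D, X ⟶ X)
    (hx : ∀ (h : H) (X : D), h • x X = Coalgebra.counit (R := k) h • x X)
    (w : Chain k D M 0) :
    boundary k H D M 0 (LinearMap.lTensor M (CN.insAlt k x 0) w) =
      ∑ l : Fin 1, (LinearMap.lTensor M (CN.slot k (preComp k x) l) w -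
        LinearMap.lTensor M (CN.slot k (postComp k x) l) w) := by
  have h1 : ∀ v : Chain k D M 0, chainFace k M 0 (LinearMap.lTensor M (CN.ins k x (Fin.last 1)) v) =
      LinearMap.lTensor M (CN.slot k (preComp k x) 0) v :=
    chainFace_lTensor_eq _ fun c => CN.face_ins_add_one k x _ _ rfl c
  have h2 : ∀ v : Chain k D M 0,
      chainLastFace k H D M 0 (LinearMap.lTensor M (CN.ins k x (Fin.last 1)) v) =
      LinearMap.lTensor M (CN.slot k (postComp k x) 0) v := by
    intro v
    rw [chainLastFace, LinearMap.comp_apply,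
      chainT_lTensor_counit fun b c => CN.twistedRot_ins_last k x hx b c]
    exact chainFace_lTensor_eq _ (fun c => CN.face_ins_self k x _ _ rfl c) _
  have h3 : (0 : Fin 1).succ = Fin.last 1 := rfl
  rw [CN.insAlt, lTensor_sum_smul]
  simp only [boundary, Fin.sum_univ_succ, Fin.sum_univ_zero, add_zero, h3, LinearMap.add_apply,
    LinearMap.smul_apply, h1, h2, Fin.val_zero, pow_zero, one_smul, zero_add, pow_one, neg_smul,
    sub_eq_add_neg]

variable (M) in
/-- The sum over all factors of a cyclic cocycle applied to the commutator of the factor with an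
invariant family `x` is a coboundary. -/
theorem commutator_mem_coboundaries (x : ∀ X : D, X ⟶ X)
    (hx : ∀ (h : H) (X : D), h • x X = Coalgebra.counit (R := k) h • x X) {n : ℕ}
    {φ : Cochain k D M n} (hφ : φ ∈ Cocycles k H D M n) :
    ∑ l : Fin (n + 1), (φ ∘ₗ LinearMap.lTensor M (CN.slot k (preComp k x) l) -
      φ ∘ₗ LinearMap.lTensor M (CN.slot k (postComp k x) l)) ∈ Coboundaries k H D M n := by
  have hb : ∀ w, φ (boundary k H D M n w) = 0 := fun w => by
    rw [← hochschildB_apply, LinearMap.mem_ker.mp hφ.2, LinearMap.zero_apply]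
  cases n with
  | zero =>
    -- In degree zero the only coboundary is `0`, so the sum itself has to vanish.
    change _ = _
    refine LinearMap.ext fun w => ?_
    have := hb (LinearMap.lTensor M (CN.insAlt k x 0) w)
    rw [boundary_insAlt_zero x hx] at this
    simpa only [map_sum, map_sub, LinearMap.sum_apply, LinearMap.sub_apply, LinearMap.comp_apply,
      LinearMap.zero_apply] using this
  | succ n =>
    -- The cobounding cochain is `φ ∘ insAlt`; the other half of the homotopy formula dies because
    -- `φ` is a cocycle.
    refine ⟨_, insAlt_mem_cyclicCochain x hx hφ.1, LinearMap.ext fun w => ?_⟩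
    have := congrArg φ (boundary_insAlt x hx w)
    rw [map_add, hb, zero_add] at this
    rw [hochschildB_apply, LinearMap.comp_apply, this]
    simp only [map_sum, map_sub, LinearMap.sum_apply, LinearMap.sub_apply, LinearMap.comp_apply]

end ChainLevel

/-! ## Separating the factors of a tensor product of tensor products -/

section SplitTensor

variable (k : Type uk) [Field k] (A : Type uA) [Ring A] [Algebra k A]

/-- `v ⊗ t ↦ v ⊗ t`, as a bilinear map. -/
def consPi {n : ℕ} (V : Fin (n + 1) → Type uM) [∀ i, AddCommGroup (V i)] [∀ i, Module k (V i)] :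
    V 0 →ₗ[k] (⨂[k] i : Fin n, V i.succ) →ₗ[k] ⨂[k] i, V i :=
  (PiTensorProduct.lift (R := k)).toLinearMap ∘ₗ (PiTensorProduct.tprod k (s := V)).curryLeft

theorem consPi_tprod {n : ℕ} (V : Fin (n + 1) → Type uM) [∀ i, AddCommGroup (V i)]
    [∀ i, Module k (V i)] (v : V 0) (w : ∀ i : Fin n, V i.succ) :
    consPi k V v (PiTensorProduct.tprod k w) = PiTensorProduct.tprod k (Fin.cons v w) := by
  simp only [consPi, LinearMap.comp_apply, LinearEquiv.coe_coe, PiTensorProduct.lift.tprod]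
  rfl

/-- `(v₁ ⊗ a₁, …, vₙ ⊗ aₙ) ↦ (v₁ ⊗ ⋯ ⊗ vₙ) ⊗ a₁ ⋯ aₙ`. -/
def splitTensor : (n : ℕ) → (V : Fin n → Type uM) → [∀ i, AddCommGroup (V i)] →
    [∀ i, Module k (V i)] → MultilinearMap k (fun i => V i ⊗[k] A) ((⨂[k] i, V i) ⊗[k] A)
  | 0, V, _, _ => MultilinearMap.constOfIsEmpty k _
      (PiTensorProduct.tprod k (fun i => i.elim0) ⊗ₜ 1)
  | n + 1, V, _, _ => LinearMap.uncurryLeft (M := fun i => V i ⊗[k] A) (TensorProduct.lift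
      (LinearMap.mk₂ k
        (fun v a => (TensorProduct.map (consPi k V v) (LinearMap.mul k A a)).compMultilinearMap
          (splitTensor n (fun i => V i.succ)))
        (fun v v' a => by ext; simp [TensorProduct.map_add_left])
        (fun r v a => by ext; simp [TensorProduct.map_smul_left])
        (fun v a a' => by ext; simp [TensorProduct.map_add_right])
        (fun r v a => by ext; simp [TensorProduct.map_smul_right])))

theorem splitTensor_tmul {n : ℕ} (V : Fin n → Type uM) [∀ i, AddCommGroup (V i)]
    [∀ i, Module k (V i)] (v : ∀ i, V i) (a : Fin n → A) :
    splitTensor k A n V (fun i => v i ⊗ₜ[k] a i) =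
      PiTensorProduct.tprod k v ⊗ₜ[k] (List.ofFn a).prod := by
  induction n with
  | zero =>
    simp only [splitTensor, List.ofFn_zero, List.prod_nil]
    exact congrArg (fun w => PiTensorProduct.tprod k w ⊗ₜ[k] (1 : A)) (funext fun i => i.elim0)
  | succ n ih =>
    have := ih (fun i => V i.succ) (fun i => v i.succ) (fun i => a i.succ)
    simp only [splitTensor, LinearMap.uncurryLeft_apply, TensorProduct.lift.tmul,
      LinearMap.mk₂_apply, LinearMap.compMultilinearMap_apply]
    rw [show Fin.tail (fun i => v i ⊗ₜ[k] a i) = fun i : Fin n => v i.succ ⊗ₜ[k] a i.succ from rfl,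
      this, TensorProduct.map_tmul, consPi_tprod, List.ofFn_succ, List.prod_cons]
    congr 2
    exact Fin.cons_self_tail v

variable {k A} in
theorem multilinear_tmul_ext {n : ℕ} {V : Fin n → Type uM} [∀ i, AddCommGroup (V i)]
    [∀ i, Module k (V i)] {N : Type*} [AddCommMonoid N] [Module k N]
    {F G : MultilinearMap k (fun i => V i ⊗[k] A) N}
    (h : ∀ (v : ∀ i, V i) (a : Fin n → A),
      F (fun i => v i ⊗ₜ[k] a i) = G (fun i => v i ⊗ₜ[k] a i)) : F = G := by
  induction n with
  | zero =>
    ext m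
    have := h (fun i => i.elim0) (fun i => i.elim0)
    convert this
  | succ n ih =>
    rw [← MultilinearMap.uncurry_curryLeft F, ← MultilinearMap.uncurry_curryLeft G]
    congr 1
    refine TensorProduct.ext' fun v a => ih fun w b => ?_
    have := h (Fin.cons v w) (Fin.cons a b)
    simp only [MultilinearMap.curryLeft_apply]
    convert this using 2
    all_goals
      funext i
      refine Fin.cases ?_ (fun i => ?_) i <;> rfl

/-- The contraction index is `i.castSucc`, hence never the last one, at which `Fin.contractNth`
would drop a factor. -/
theorem prod_ofFn_contractNth {G : Type*} [Monoid G] {n : ℕ} (i : Fin (n + 1))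
    (a : Fin (n + 2) → G) :
    (List.ofFn (Fin.contractNth i.castSucc (· * ·) a)).prod = (List.ofFn a).prod := by
  have h := congrFun (Fin.partialProd_contractNth a i.castSucc) (Fin.last _)
  have e : ∀ {m : ℕ} (b : Fin m → G), Fin.partialProd b (Fin.last m) = (List.ofFn b).prod := by
    intro m b
    unfold Fin.partialProd
    rw [List.take_of_length_le (by simp)]
  rw [e] at h
  rw [h, Function.comp_apply, ← e]
  congr 1
  exact Fin.succAbove_ne_last_last (Fin.ne_of_lt (by
    rw [Fin.lt_def, Fin.val_succ, Fin.val_castSucc, Fin.val_last]; omega))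

theorem trace_prod_rotate {A' : Type*} [Ring A'] {N : Type*} {n : ℕ} (θ : A' → N)
    (hθ : ∀ a b, θ (a * b) = θ (b * a)) (a : Fin (n + 1) → A') :
    θ (List.ofFn fun i => a (i - 1)).prod = θ (List.ofFn a).prod := by
  rw [List.ofFn_succ, List.prod_cons, hθ]
  congr 1
  have e : ∀ i : Fin n, i.succ - 1 = i.castSucc := by
    intro i
    rw [sub_eq_iff_eq_add]
    simp
  have e' : (0 - 1 : Fin (n + 1)) = Fin.last n := by
    rw [sub_eq_iff_eq_add]; simp
  simp only [e, e']
  rw [List.ofFn_succ' a, List.concat_eq_append, List.prod_append]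
  simp

end SplitTensor

/-! ## The trace -/

section Trace

variable {k : Type uk} {H : Type uH} {D : Type uD} {A : Type uA}
  [Field k] [Ring H] [HopfAlgebra k H] [Ring A] [Algebra k A]
  [Category.{vD} D] [Preadditive D] [Linear k D] [HCategory k H D]

namespace TensorCat

/-- The morphism `f ⊗ a`. -/
def pure {X Y : TensorCat k D A} (f : X.base ⟶ Y.base) (a : A) : X ⟶ Y := f ⊗ₜ[k] a

theorem pure_comp {X Y Z : TensorCat k D A} (f : X.base ⟶ Y.base) (g : Y.base ⟶ Z.base)
    (a b : A) : (pure f a : X ⟶ Y) ≫ (pure g b : Y ⟶ Z) = pure (f ≫ g) (b * a) :=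
  TensorCat.compL_tmul f g a b

theorem hsmul_pure {X Y : TensorCat k D A} (h : H) (f : X.base ⟶ Y.base) (a : A) :
    h • (pure f a : X ⟶ Y) = pure (h • f) a :=
  TensorProduct.smul_tmul' h f a

/-- The bilinear map `(f, a) ↦ f ⊗ a`. -/
def pureL (X Y : TensorCat k D A) : (X.base ⟶ Y.base) →ₗ[k] A →ₗ[k] (X ⟶ Y) :=
  TensorProduct.mk k (X.base ⟶ Y.base) A

theorem pureL_apply {X Y : TensorCat k D A} (f : X.base ⟶ Y.base) (a : A) :
    pureL X Y f a = pure f a := rfl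

/-- The linear map on `Hom(X, Y)` given by a bilinear map. -/
def homLift {N : Type*} [AddCommMonoid N] [Module k N] {X Y : TensorCat k D A}
    (F : (X.base ⟶ Y.base) →ₗ[k] A →ₗ[k] N) : (X ⟶ Y) →ₗ[k] N where
  toFun := TensorProduct.lift F
  map_add' u v := (TensorProduct.lift F).map_add u v
  map_smul' r u := (TensorProduct.lift F).map_smul r u

theorem homLift_pure {N : Type*} [AddCommMonoid N] [Module k N] {X Y : TensorCat k D A}
    (F : (X.base ⟶ Y.base) →ₗ[k] A →ₗ[k] N) (f : X.base ⟶ Y.base) (a : A) :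
    homLift F (pure f a) = F f a := TensorProduct.lift.tmul f a

/-- The total morphism `f ⊗ a`. -/
def pureMor (a : A) (m : Mor D) : Mor (TensorCat k D A) :=
  Mor.of (pure m.hom a : (⟨m.dom⟩ : TensorCat k D A) ⟶ ⟨m.cod⟩)

theorem pureMor_comp (a b : A) {m m' : Mor D} (h : m'.cod = m.dom) :
    (pureMor a m).comp (pureMor b m') = pureMor (k := k) (a * b) (m.comp m') := by
  obtain ⟨X, Y, f⟩ := m
  obtain ⟨Z, W, g⟩ := m'
  obtain rfl : W = X := h
  change (Mor.of (pure f a : (⟨W⟩ : TensorCat k D A) ⟶ ⟨Y⟩)).comp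
    (Mor.of (pure g b : (⟨Z⟩ : TensorCat k D A) ⟶ ⟨W⟩)) =
      pureMor (a * b) ((Mor.of f).comp (Mor.of g))
  rw [Mor.comp_of, Mor.comp_of, pure_comp]
  rfl

end TensorCat

open TensorCat

variable (k) in
/-- `(f⁰ ⊗ a₀) ⊗ ⋯ ⊗ (fⁿ ⊗ aₙ)`. -/
def CN.genPure {n : ℕ} (X : Fin (n + 1) → D)
    (f : ∀ l : Fin (n + 1), X (l + 1) ⟶ X l) (a : Fin (n + 1) → A) :
    CN k (TensorCat k D A) n :=
  CN.gen k (fun l => (⟨X l⟩ : TensorCat k D A)) (fun l => pure (f l) (a l))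

theorem arr_pure {n : ℕ} (X : Fin (n + 1) → D)
    (f : ∀ l : Fin (n + 1), X (l + 1) ⟶ X l) (a : Fin (n + 1) → A) (j : ℕ) :
    arr (X := fun l => (⟨X l⟩ : TensorCat k D A)) (fun l => pure (f l) (a l)) j =
      pureMor (a (Fin.ofNat _ j)) (arr f j) := rfl

theorem CN.pure_hom_ext {n : ℕ} {N : Type*} [AddCommMonoid N] [Module k N]
    {F G : CN k (TensorCat k D A) n →ₗ[k] N}
    (h : ∀ (X : Fin (n + 1) → D)
      (f : ∀ l : Fin (n + 1), X (l + 1) ⟶ X l) (a : Fin (n + 1) → A),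
      F (CN.genPure k X f a) = G (CN.genPure k X f a)) : F = G := by
  refine CN.hom_ext fun X u => ?_
  let P : MultilinearMap k (fun l => ((X (l + 1)).base ⟶ (X l).base) ⊗[k] A)
      (CN k (TensorCat k D A) n) :=
    ((CN.incl X).compMultilinearMap (PiTensorProduct.tprod k)).compLinearMap
      (fun l => TensorProduct.lift (pureL (X (l + 1)) (X l)))
  have e : F.compMultilinearMap P = G.compMultilinearMap P := by
    refine multilinear_tmul_ext fun f a => ?_
    have := h (fun l => (X l).base) f a
    simp only [LinearMap.compMultilinearMap_apply, P, MultilinearMap.compLinearMap_apply,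
      TensorProduct.lift.tmul]
    exact this
  -- Morphism spaces of `D ⊗ A` are tensor products by definition, so the lift of `pureL` is the
  -- identity and `P u` is the generator of `u`.
  have e' : ∀ l, TensorProduct.lift (pureL (X (l + 1)) (X l)) (u l) = u l := by
    intro l
    exact LinearMap.congr_fun (TensorProduct.lift_mk (R := k)
      (M := ((X (l + 1)).base ⟶ (X l).base)) (N := A)) (u l)
  have := congrArg (fun Z => Z u) e
  simp only [LinearMap.compMultilinearMap_apply, P, MultilinearMap.compLinearMap_apply] at this
  simp only [e'] at this
  exact this

variable (θ : A →ₗ[k] k)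

variable (k D) in
/-- The map `(f⁰ ⊗ a₀) ⊗ ⋯ ⊗ (fⁿ ⊗ aₙ) ↦ θ(a₀ ⋯ aₙ) f⁰ ⊗ ⋯ ⊗ fⁿ` on the cyclic nerve. -/
def CN.trace (n : ℕ) : CN k (TensorCat k D A) n →ₗ[k] CN k D n :=
  CN.desc fun X => CN.incl (fun l => (X l).base) ∘ₗ PiTensorProduct.lift
    (((TensorProduct.rid k _).toLinearMap ∘ₗ LinearMap.lTensor _ θ).compMultilinearMap
      ((splitTensor k A (n + 1) (fun l => (X (l + 1)).base ⟶ (X l).base)).compLinearMap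
        (fun l => homLift (TensorProduct.mk k ((X (l + 1)).base ⟶ (X l).base) A))))

theorem CN.trace_genPure {n : ℕ} (X : Fin (n + 1) → D)
    (f : ∀ l : Fin (n + 1), X (l + 1) ⟶ X l) (a : Fin (n + 1) → A) :
    CN.trace k D θ n (CN.genPure k X f a) =
      θ (List.ofFn a).prod • CN.gen k X f := by
  simp only [CN.trace, CN.genPure, CN.desc_gen, LinearMap.comp_apply, PiTensorProduct.lift.tprod,
    LinearMap.compMultilinearMap_apply, MultilinearMap.compLinearMap_apply, homLift_pure,
    TensorProduct.mk_apply, splitTensor_tmul, LinearMap.lTensor_tmul, LinearEquiv.coe_coe,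
    TensorProduct.rid_tmul, map_smul]
  rfl

/-- The map of cyclic nerves given by a trace `θ` on `A`. -/
def traceNerve (hθ : ∀ a b, θ (a * b) = θ (b * a)) : NerveMap k H (TensorCat k D A) D where
  app := CN.trace k D θ
  app_face {n} i c := by
    suffices e : CN.trace k D θ n ∘ₗ CN.face i = CN.face i ∘ₗ CN.trace k D θ (n + 1) from
      LinearMap.congr_fun e c
    refine CN.pure_hom_ext fun X f a => ?_
    have e : CN.face i (CN.genPure k X f a) = CN.genPure k (faceObj i X)
        (faceFun i X f) (Fin.contractNth i.castSucc (· * ·) a) := by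
      unfold CN.genPure
      rw [CN.face_gen]
      refine CN.gen_congr fun j hj => ?_
      rw [arr_faceFun _ _ _ hj, arr_pure, arr_pure, arr_pure, arr_faceFun _ _ _ hj]
      obtain ⟨j, rfl⟩ : ∃ q : Fin (n + 1), q.val = j := ⟨⟨j, by omega⟩, rfl⟩
      have e1 : Fin.ofNat (n + 2) j.val = j.castSucc := Fin.ofNat_val_eq_self j.castSucc
      have e2 : Fin.ofNat (n + 2) (j.val + 1) = j.succ := Fin.ofNat_val_eq_self j.succ
      have e3 : Fin.ofNat (n + 1) j.val = j := Fin.ofNat_val_eq_self j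
      rw [e1, e2, e3]
      unfold Fin.contractNth
      simp only [Fin.val_castSucc]
      split_ifs
      · rfl
      · exact pureMor_comp (k := k) _ _ (arr_dom f j.val).symm
      · rfl
    simp only [LinearMap.comp_apply, e, CN.trace_genPure, map_smul, CN.face_gen]
    -- Composition multiplies adjacent coefficients in the order of their indices, so a face leaves
    -- `a₀ ⋯ aₙ` unchanged.
    rw [prod_ofFn_contractNth]
  app_twistedRot {n} b c := by
    suffices e : CN.trace k D θ n ∘ₗ CN.twistedRot k b = CN.twistedRot k b ∘ₗ CN.trace k D θ n from
      LinearMap.congr_fun e c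
    refine CN.pure_hom_ext fun X f a => ?_
    have e : CN.twistedRot k b (CN.genPure k X f a) = CN.genPure k (rotObj X)
        (Function.update (rotFun X f) 0 (b • rotFun X f 0)) (fun l => a (l - 1)) := by
      unfold CN.genPure
      rw [CN.twistedRot_gen]
      refine CN.gen_congr fun j hj => ?_
      rw [arr_twistedRot _ _ _ _ hj, arr_pure, arr_pure, arr_pure, arr_twistedRot _ _ _ _ hj]
      rcases j with _ | j
      · have h : a (Fin.ofNat (n + 1) n) = a (Fin.ofNat (n + 1) 0 - 1) := by
          congr 1
          rw [eq_sub_iff_add_eq, ← fin_ofNat_succ]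
          apply Fin.ext; simp
        rw [if_pos rfl, if_pos rfl, ← h]
        exact congrArg (fun u => Mor.of u) (hsmul_pure _ _ _)
      · rw [if_neg (Nat.succ_ne_zero _), if_neg (Nat.succ_ne_zero _), Nat.add_sub_cancel,
          fin_ofNat_succ, add_sub_cancel_right]
    simp only [LinearMap.comp_apply, e, CN.trace_genPure, map_smul, CN.twistedRot_gen]
    -- The trace property of `θ` is needed only here; faces and the `H`-action work for any
    -- functional.
    rw [trace_prod_rotate θ hθ]
  app_act {n} b c := by
    suffices e : CN.trace k D θ n ∘ₗ CN.act k b = CN.act k b ∘ₗ CN.trace k D θ n from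
      LinearMap.congr_fun e c
    refine CN.pure_hom_ext fun X f a => ?_
    simp only [LinearMap.comp_apply, CN.trace_genPure, map_smul, CN.act_gen]
    rw [CN.genPure, CN.act_gen]
    suffices e : CN.trace k D θ n ∘ₗ
        CN.actTensor k (fun l => (⟨X l⟩ : TensorCat k D A)) (fun l => pure (f l) (a l)) =
        θ (List.ofFn a).prod • CN.actTensor k X f from
      LinearMap.congr_fun e _
    refine PiTensorProduct.ext (MultilinearMap.ext fun t => ?_)
    simp only [LinearMap.compMultilinearMap_apply, LinearMap.comp_apply, CN.actTensor_tprod,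
      LinearMap.smul_apply, hsmul_pure]
    exact CN.trace_genPure θ X (fun l => t l • f l) a

end Trace

open TensorCat

/-! ## Invariant morphisms -/

section Invariant

variable {k : Type uk} {H : Type uH} {C : Type uC} [Field k] [Ring H] [HopfAlgebra k H]
  [Category.{vC} C] [Preadditive C] [Linear k C] [HCategory k H C]

variable (k H) in
/-- `h v = ε(h) v` for all `h`. -/
def IsInvariant {X Y : C} (v : X ⟶ Y) : Prop :=
  ∀ h : H, h • v = Coalgebra.counit (R := k) h • v

theorem exists_comul_eq_sum (h : H) : ∃ (r : ℕ) (a b : Fin r → H),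
    Coalgebra.comul (R := k) h = ∑ i, a i ⊗ₜ[k] b i := by
  let R := Coalgebra.Repr.arbitrary k h
  refine ⟨R.index.card, fun i => R.left (R.index.equivFin.symm i),
    fun i => R.right (R.index.equivFin.symm i), ?_⟩
  rw [← R.eq, ← Finset.sum_coe_sort]
  exact (Equiv.sum_comp R.index.equivFin.symm
    (fun i : R.index => R.left i ⊗ₜ[k] R.right i)).symm

theorem sum_counit_smul_fin {h : H} {r : ℕ} {a b : Fin r → H}
    (hab : Coalgebra.comul (R := k) h = ∑ i, a i ⊗ₜ[k] b i) :
    ∑ i, Coalgebra.counit (R := k) (a i) • b i = h :=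
  Coalgebra.sum_counit_smul (R := k) (⟨Finset.univ, a, b, hab.symm⟩ : Coalgebra.Repr k h (Fin r))

theorem sum_smul_counit_fin {h : H} {r : ℕ} {a b : Fin r → H}
    (hab : Coalgebra.comul (R := k) h = ∑ i, a i ⊗ₜ[k] b i) :
    ∑ i, Coalgebra.counit (R := k) (b i) • a i = h := by
  have := congrArg (TensorProduct.rid k H) (Coalgebra.sum_tmul_counit_eq (R := k)
    (repr := (⟨Finset.univ, a, b, hab.symm⟩ : Coalgebra.Repr k h (Fin r))))
  simpa only [map_sum, TensorProduct.rid_tmul, one_smul] using this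

/-- The leg of `Δ(h)` that meets `v` acts by its counit, and the counit law restores `h` on the
other factor. -/
theorem IsInvariant.hsmul_comp {X Y Z : C} {v : X ⟶ Y} (hv : IsInvariant k H v) (h : H)
    (f : Y ⟶ Z) : h • (v ≫ f) = v ≫ (h • f) := by
  obtain ⟨r, a, b, hab⟩ := exists_comul_eq_sum (k := k) h
  rw [HCategory.smul_comp h v f r a b hab]
  conv_rhs => rw [← sum_smul_counit_fin hab, Finset.sum_smul, Preadditive.comp_sum]
  refine Finset.sum_congr rfl fun i _ => ?_
  rw [hv, Linear.smul_comp, smul_assoc, Linear.comp_smul]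

theorem IsInvariant.hsmul_comp' {X Y Z : C} {v : Y ⟶ Z} (hv : IsInvariant k H v) (h : H)
    (f : X ⟶ Y) : h • (f ≫ v) = (h • f) ≫ v := by
  obtain ⟨r, a, b, hab⟩ := exists_comul_eq_sum (k := k) h
  rw [HCategory.smul_comp h f v r a b hab]
  conv_rhs => rw [← sum_counit_smul_fin hab, Finset.sum_smul, Preadditive.sum_comp]
  refine Finset.sum_congr rfl fun i _ => ?_
  rw [hv, Linear.comp_smul, smul_assoc, Linear.smul_comp]

theorem isInvariant_id (X : C) : IsInvariant k H (𝟙 X) := fun h => HCategory.smul_id h X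

/-- Apply `h` to `u.inv ≫ u.hom = 𝟙`. Since `u.hom` is invariant, `h` reaches only the inverse, and
`u.hom` can be cancelled. -/
theorem IsInvariant.inv {X Y : C} {u : X ≅ Y} (hu : IsInvariant k H u.hom) :
    IsInvariant k H u.inv := fun h => by
  have h1 := hu.hsmul_comp' h u.inv
  rw [u.inv_hom_id, HCategory.smul_id (k := k)] at h1
  have h2 := congrArg (fun w => w ≫ u.inv) h1
  simp only [Linear.smul_comp, Category.id_comp, Category.assoc, u.hom_inv_id,
    Category.comp_id] at h2
  exact h2.symm

end Invariant

/-! ## Matrix units -/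

section MatrixUnits

variable {J : Type} [Fintype J] [DecidableEq J] {R : Type*} [CommRing R]

theorem single_mul_single_ite (i j i' j' : J) (a b : R) :
    Matrix.single i j a * Matrix.single i' j' b =
      if j = i' then Matrix.single i j' (a * b) else 0 := by
  split_ifs with h
  · subst h; rw [Matrix.single_mul_single_same]
  · rw [Matrix.single_mul_single_of_ne _ _ _ _ h]

/-- With only row `i₀` nonzero, a path of indices from `i₀` to `i₀` contributes only if it stays at
`i₀`, so this entry is multiplicative. The vanishing in the rest of column `i₀` is carried along for
the induction. -/
theorem prod_apply_of_row {n : ℕ} (i₀ : J) (a : Fin n → Matrix J J R)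
    (ha : ∀ l i j, i ≠ i₀ → a l i j = 0) :
    (∀ i, i ≠ i₀ → (List.ofFn a).prod i i₀ = 0) ∧
      (List.ofFn a).prod i₀ i₀ = ∏ l, a l i₀ i₀ := by
  induction n with
  | zero => simp +contextual
  | succ n ih =>
    obtain ⟨h1, h2⟩ := ih (fun l => a l.succ) fun l => ha l.succ
    rw [List.ofFn_succ, List.prod_cons]
    refine ⟨fun i hi => ?_, ?_⟩
    · rw [Matrix.mul_apply]
      exact Finset.sum_eq_zero fun j _ => by rw [ha 0 i j hi, zero_mul]
    · rw [Matrix.mul_apply, Finset.sum_eq_single i₀ (fun j _ hj => by rw [h1 j hj, mul_zero])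
        (fun h => absurd (Finset.mem_univ _) h), h2, Fin.prod_univ_succ]

theorem trace_prod_of_row {n : ℕ} (i₀ : J) (a : Fin (n + 1) → Matrix J J R)
    (ha : ∀ l i j, i ≠ i₀ → a l i j = 0) :
    (List.ofFn a).prod.trace = ∏ l, a l i₀ i₀ := by
  rw [← (prod_apply_of_row i₀ a ha).2, Matrix.trace]
  refine Finset.sum_eq_single i₀ (fun i _ hi => ?_) (fun h => absurd (Finset.mem_univ _) h)
  rw [Matrix.diag_apply, List.ofFn_succ, List.prod_cons, Matrix.mul_apply]
  exact Finset.sum_eq_zero fun j _ => by rw [ha 0 i j hi, zero_mul]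

theorem trace_prod_diagonal {n : ℕ} (d : Fin n → J → R) :
    (List.ofFn fun l => Matrix.diagonal (d l)).prod.trace = ∑ i, ∏ l, d l i := by
  have h := map_list_prod (Matrix.diagonalRingHom J R) (List.ofFn d)
  rw [List.map_ofFn] at h
  have h' : (Matrix.diagonalRingHom J R) ∘ d = fun l => Matrix.diagonal (d l) := rfl
  rw [← h', ← h, List.prod_ofFn]
  change (Matrix.diagonal (∏ l, d l)).trace = _
  rw [Matrix.trace_diagonal]
  simp only [Finset.prod_apply]

theorem derivative_mapMatrix_mul (a b : Matrix J J (Polynomial R)) :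
    (Polynomial.derivative (R := R)).mapMatrix (a * b) =
      (Polynomial.derivative (R := R)).mapMatrix a * b +
        a * (Polynomial.derivative (R := R)).mapMatrix b := by
  ext1 i j
  simp only [LinearMap.mapMatrix_apply, Matrix.map_apply, Matrix.mul_apply, Matrix.add_apply,
    map_sum, Polynomial.derivative_mul, Finset.sum_add_distrib]

theorem leibniz_prod_ofFn {A : Type*} [Ring A] (δ : A →+ A)
    (hδ : ∀ a b, δ (a * b) = δ a * b + a * δ b) {n : ℕ} (a : Fin n → A) :
    δ (List.ofFn a).prod = ∑ l, (List.ofFn fun j => if j = l then δ (a j) else a j).prod := by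
  induction n with
  | zero =>
    have := hδ 1 1
    simp only [mul_one, one_mul] at this
    simpa using this
  | succ n ih =>
    rw [List.ofFn_succ, List.prod_cons, hδ, ih, Fin.sum_univ_succ]
    simp only [List.ofFn_succ, List.prod_cons, if_true, Fin.succ_ne_zero, if_false,
      (Fin.succ_ne_zero _).symm, Fin.succ_inj, Finset.mul_sum]

end MatrixUnits

/-! ## Traces of sums of pure morphisms -/

section TraceSums

variable {k : Type uk} {D : Type uD} {A : Type uA}
  [Field k] [Ring A] [Algebra k A] [Category.{vD} D] [Preadditive D] [Linear k D]

theorem CN.gen_sum {n : ℕ} {ι : Type} [Fintype ι] [DecidableEq ι] (X : Fin (n + 1) → D)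
    (v : ∀ l : Fin (n + 1), ι → (X (l + 1) ⟶ X l)) :
    CN.gen k X (fun l => ∑ r, v l r) =
      ∑ s : Fin (n + 1) → ι, CN.gen k X (fun l => v l (s l)) := by
  simp only [CN.gen]
  rw [MultilinearMap.map_sum, map_sum]

theorem CN.gen_smul {n : ℕ} (X : Fin (n + 1) → D) (r : Fin (n + 1) → k)
    (v : ∀ l : Fin (n + 1), X (l + 1) ⟶ X l) :
    CN.gen k X (fun l => r l • v l) = (∏ l, r l) • CN.gen k X v := by
  simp only [CN.gen]
  rw [MultilinearMap.map_smul_univ, map_smul]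

/-- If `θ` is a sum of multiplicative functions on words in the coefficients, the multilinear
expansion can be refactored into one generator for each of them. It is applied with one function per
diagonal entry to diagonal matrices, and with a single function to matrices supported in one row. -/
theorem CN.trace_gen_sum {n : ℕ} {ι S : Type} [Fintype ι] [DecidableEq ι] [Fintype S]
    (θ : A →ₗ[k] k) (e : ι → A) (χ : S → ι → k)
    (h : ∀ s : Fin (n + 1) → ι, θ (List.ofFn fun l => e (s l)).prod = ∑ c, ∏ l, χ c (s l))
    (X : Fin (n + 1) → D) (v : ∀ l : Fin (n + 1), ι → (X (l + 1) ⟶ X l)) :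
    CN.trace k D θ n (CN.gen k (fun l => (⟨X l⟩ : TensorCat k D A))
      (fun l => ∑ r, pure (v l r) (e r))) =
      ∑ c, CN.gen k X (fun l => ∑ r, χ c r • v l r) := by
  rw [CN.gen_sum, map_sum]
  have h1 : ∀ s : Fin (n + 1) → ι, CN.trace k D θ n (CN.gen k
      (fun l => (⟨X l⟩ : TensorCat k D A)) (fun l => pure (v l (s l)) (e (s l)))) =
      (∑ c, ∏ l, χ c (s l)) • CN.gen k X (fun l => v l (s l)) := by
    intro s
    rw [← h s]
    exact CN.trace_genPure θ X (fun l => v l (s l)) (fun l => e (s l))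
  simp only [h1, CN.gen_sum, CN.gen_smul, Finset.sum_smul]
  exact Finset.sum_comm

theorem CN.trace_sub (θ θ' : A →ₗ[k] k) (n : ℕ) (c : CN k (TensorCat k D A) n) :
    CN.trace k D (θ - θ') n c = CN.trace k D θ n c - CN.trace k D θ' n c := by
  suffices e : CN.trace k D (θ - θ') n = CN.trace k D θ n - CN.trace k D θ' n from
    LinearMap.congr_fun e c
  refine CN.pure_hom_ext fun X f a => ?_
  simp only [LinearMap.sub_apply, CN.trace_genPure]
  exact sub_smul (θ _) (θ' _) (CN.gen k X f)

/-- The map `f ⊗ a ↦ f ⊗ δ(a)`. -/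
def mapCoeff (δ : A →ₗ[k] A) (X Y : TensorCat k D A) : (X ⟶ Y) →ₗ[k] (X ⟶ Y) :=
  homLift ((pureL X Y).compl₂ δ)

theorem mapCoeff_pure (δ : A →ₗ[k] A) {X Y : TensorCat k D A} (f : X.base ⟶ Y.base) (a : A) :
    mapCoeff δ X Y (pure f a) = pure f (δ a) := by
  rw [mapCoeff, homLift_pure]; rfl

/-- By the Leibniz rule, applying `δ` to one coefficient at a time and summing differentiates the
product `a₀ ⋯ aₙ`. -/
theorem CN.sum_trace_slot_mapCoeff (θ : A →ₗ[k] k) (δ : A →ₗ[k] A)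
    (hδ : ∀ a b, δ (a * b) = δ a * b + a * δ b) (n : ℕ) (c : CN k (TensorCat k D A) n) :
    ∑ l, CN.trace k D θ n (CN.slot k (mapCoeff δ) l c) = CN.trace k D (θ ∘ₗ δ) n c := by
  suffices e : ∑ l, CN.trace k D θ n ∘ₗ CN.slot k (mapCoeff δ) l = CN.trace k D (θ ∘ₗ δ) n by
    rw [← e, LinearMap.sum_apply]; rfl
  refine CN.pure_hom_ext fun X f a => ?_
  have h : ∀ l, CN.slot k (mapCoeff δ) l (CN.genPure k X f a) =
      CN.genPure k X f (fun j => if j = l then δ (a j) else a j) := by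
    intro l
    unfold CN.genPure
    rw [CN.slot_gen]
    congr 1
    funext j
    dsimp only
    split_ifs
    · exact mapCoeff_pure δ (f j) (a j)
    · rfl
  simp only [LinearMap.sum_apply, LinearMap.comp_apply, h, CN.trace_genPure]
  rw [← Finset.sum_smul, ← map_sum]
  exact congrArg (fun t => θ t • CN.gen k X f) (leibniz_prod_ofFn δ.toAddMonoidHom hδ a).symm

theorem CN.slot_eq_zero {n : ℕ} (g : ∀ X Y : D, (X ⟶ Y) →ₗ[k] (X ⟶ Y)) (l : Fin (n + 1))
    (X : Fin (n + 1) → D) (f : ∀ l : Fin (n + 1), X (l + 1) ⟶ X l)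
    (h : g _ _ (f l) = 0) : CN.slot k g l (CN.gen k X f) = 0 := by
  rw [CN.slot_gen, CN.gen, MultilinearMap.map_coord_zero _ l, map_zero]
  rw [if_pos rfl, h]

theorem CN.slot_congr {n : ℕ} (g g' : ∀ X Y : D, (X ⟶ Y) →ₗ[k] (X ⟶ Y)) (l : Fin (n + 1))
    (X : Fin (n + 1) → D) (f : ∀ l : Fin (n + 1), X (l + 1) ⟶ X l)
    (h : g _ _ (f l) = g' _ _ (f l)) :
    CN.slot k g l (CN.gen k X f) = CN.slot k g' l (CN.gen k X f) := by
  rw [CN.slot_gen, CN.slot_gen]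
  congr 1
  funext j
  split_ifs with hj
  · subst hj; exact h
  · rfl

end TraceSums

/-! ## Matrices of conjugated morphisms -/

section Blend

variable {k : Type uk} {H : Type uH} {D : Type uD} {C : Type uC} [Field k] [Ring H]
  [HopfAlgebra k H] [Category.{vD} D] [Preadditive D] [Linear k D] [HCategory k H D]
  [Category.{vC} C] [Preadditive C] [Linear k C] [HCategory k H C]
  {J : Type} [Fintype J] [DecidableEq J] {R : Type uA} [CommRing R] [Algebra k R]

/-- `f ↦ ∑_{i,j} (U_i ∘ f ∘ V_j) ⊗ c_i E_{ij}`. -/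
def blend (U V : J → ∀ Y : C, Y ⟶ Y) (c : J → R) (X Y : C) :
    (X ⟶ Y) →ₗ[k] ((⟨X⟩ : TensorCat k C (Matrix J J R)) ⟶ ⟨Y⟩) :=
  ∑ r : J × J, (pureL (k := k) (⟨X⟩ : TensorCat k C (Matrix J J R)) ⟨Y⟩).flip
      (Matrix.single r.1 r.2 (c r.1)) ∘ₗ
    (Linear.leftComp k Y (V r.2 X) ∘ₗ Linear.rightComp k X (U r.1 Y))

variable (U V : J → ∀ Y : C, Y ⟶ Y)

theorem blend_apply (c : J → R) {X Y : C} (f : X ⟶ Y) :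
    blend (k := k) U V c X Y f = ∑ r : J × J,
      (pure (V r.2 X ≫ f ≫ U r.1 Y) (Matrix.single r.1 r.2 (c r.1)) :
        (⟨X⟩ : TensorCat k C (Matrix J J R)) ⟶ ⟨Y⟩) := by
  rw [blend, LinearMap.sum_apply]
  rfl

theorem blend_zero {X Y : C} (f : X ⟶ Y) : blend (k := k) U V (0 : J → R) X Y f = 0 := by
  rw [blend_apply]
  refine Finset.sum_eq_zero fun r _ => ?_
  rw [Pi.zero_apply, Matrix.single_zero]
  exact TensorProduct.tmul_zero _ _

/-- A blend is the column `(c_i U_i)` times `f` times the row `(V_j)`. In a composite the inner row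
meets the inner column in `∑ c_i (V_i ∘ U_i) = ∑ c_i`. -/
theorem blend_comp (hUV : ∀ j Y, U j Y ≫ V j Y = 𝟙 Y) (c c' : J → R) {X Y Z : C} (f : X ⟶ Y)
    (g : Y ⟶ Z) :
    blend (k := k) U V c X Y f ≫ blend U V c' Y Z g =
      blend U V ((∑ i, c i) • c') X Z (f ≫ g) := by
  simp only [blend_apply, Preadditive.sum_comp, Preadditive.comp_sum, pure_comp,
    single_mul_single_ite, Fintype.sum_prod_type]
  have h : ∀ i j i' j', (pure ((V j X ≫ f ≫ U i Y) ≫ V j' Y ≫ g ≫ U i' Z)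
      (if j' = i then Matrix.single i' j (c' i' * c i) else 0) :
        (⟨X⟩ : TensorCat k C (Matrix J J R)) ⟶ ⟨Z⟩) =
      if j' = i then pureL (k := k) (⟨X⟩ : TensorCat k C (Matrix J J R)) ⟨Z⟩
        (V j X ≫ (f ≫ g) ≫ U i' Z) (Matrix.single i' j (c' i' * c i)) else 0 := by
    intro i j i' j'
    split_ifs with hi
    · subst hi
      have : (V j X ≫ f ≫ U j' Y) ≫ V j' Y ≫ g ≫ U i' Z = V j X ≫ (f ≫ g) ≫ U i' Z := by
        simp only [Category.assoc, reassoc_of% (hUV j' Y)]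
      rw [this]; rfl
    · exact TensorProduct.tmul_zero _ _
  simp only [h]
  have h' : ∀ i' j, (pure (V j X ≫ (f ≫ g) ≫ U i' Z)
        (Matrix.single i' j (((∑ i, c i) • c') i')) :
          (⟨X⟩ : TensorCat k C (Matrix J J R)) ⟶ ⟨Z⟩) =
      ∑ i, pureL (k := k) (⟨X⟩ : TensorCat k C (Matrix J J R)) ⟨Z⟩
        (V j X ≫ (f ≫ g) ≫ U i' Z) (Matrix.single i' j (c' i' * c i)) := by
    intro i' j
    rw [← map_sum, pureL_apply]
    congr 1
    rw [Pi.smul_apply, smul_eq_mul, mul_comm, Finset.mul_sum]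
    exact map_sum (Matrix.singleAddMonoidHom i' j) _ _
  simp only [h']
  refine Finset.sum_congr rfl fun i' _ => ?_
  conv_rhs => rw [Finset.sum_comm]
  refine Finset.sum_congr rfl fun j' _ => ?_
  rw [Finset.sum_eq_single j' (fun i _ hi => Finset.sum_eq_zero fun j _ => if_neg hi.symm)
    (fun hj => absurd (Finset.mem_univ _) hj)]
  simp only [if_true]

theorem blend_hsmul (hU : ∀ j Y, IsInvariant k H (U j Y)) (hV : ∀ j Y, IsInvariant k H (V j Y))
    (c : J → R) {X Y : C} (h : H) (f : X ⟶ Y) :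
    h • blend (k := k) U V c X Y f = blend U V c X Y (h • f) := by
  simp only [blend_apply, Finset.smul_sum, hsmul_pure]
  refine Finset.sum_congr rfl fun r _ => ?_
  rw [(hV _ _).hsmul_comp, (hU _ _).hsmul_comp']

theorem mapCoeff_blend (δ : R →ₗ[k] R) (c : J → R) {X Y : C} (f : X ⟶ Y) :
    mapCoeff δ.mapMatrix ⟨X⟩ ⟨Y⟩ (blend (k := k) U V c X Y f) =
      blend U V (fun i => δ (c i)) X Y f := by
  simp only [blend_apply, map_sum, mapCoeff_pure]
  refine Finset.sum_congr rfl fun r _ => ?_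
  rw [LinearMap.mapMatrix_apply, Matrix.map_single]

/-- The semifunctor `f ↦ ∑_{i,j} (U_i ∘ α(f) ∘ V_j) ⊗ c_i E_{ij}`. -/
def Semifunctor.blend (α : Semifunctor k H D C) (hUV : ∀ j Y, U j Y ≫ V j Y = 𝟙 Y)
    (hU : ∀ j Y, IsInvariant k H (U j Y)) (hV : ∀ j Y, IsInvariant k H (V j Y)) (c : J → R)
    (hc : ∑ i, c i = 1) : Semifunctor k H D (TensorCat k C (Matrix J J R)) where
  obj X := ⟨α.obj X⟩
  map {X Y} := HopfCyclic.blend U V c (α.obj X) (α.obj Y) ∘ₗ α.map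
  map_comp f g := by
    simp only [LinearMap.comp_apply]
    rw [blend_comp U V hUV, hc, one_smul, α.map_comp]
  map_hsmul h f := by
    simp only [LinearMap.comp_apply]
    rw [blend_hsmul U V hU hV, α.map_hsmul]

/-- At a point `e` where `c` becomes the indicator of `i₀`, the coefficient matrices are supported
in row `i₀`. The trace of their product is then multiplicative and sees only the entry `(i₀, i₀)` of
each factor. -/
theorem CN.trace_gen_blend {n : ℕ} (e : R →ₐ[k] k) (i₀ : J) (c : J → R)
    (hc : ∀ i, e (c i) = if i = i₀ then 1 else 0) (X : Fin (n + 1) → C)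
    (f : ∀ l : Fin (n + 1), X (l + 1) ⟶ X l) :
    CN.trace k C (e.toLinearMap ∘ₗ Matrix.traceLinearMap J k R) n
      (CN.gen k (fun l => (⟨X l⟩ : TensorCat k C (Matrix J J R)))
        (fun l => blend U V c _ _ (f l))) =
      CN.gen k X (fun l => V i₀ (X (l + 1)) ≫ f l ≫ U i₀ (X l)) := by
  simp only [blend_apply]
  rw [CN.trace_gen_sum (ι := J × J) (S := Unit) _ (fun r => Matrix.single r.1 r.2 (c r.1))
    (fun _ r => Matrix.single r.1 r.2 (e (c r.1)) i₀ i₀) ?_ X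
    (fun l r => V r.2 (X (l + 1)) ≫ f l ≫ U r.1 (X l))]
  · rw [Fintype.sum_unique]
    congr 1
    funext l
    rw [Finset.sum_eq_single (i₀, i₀)]
    · simp [hc]
    · rintro ⟨i, j⟩ - hij
      rw [Matrix.single_apply, if_neg, zero_smul]
      rintro ⟨h1, h2⟩
      exact hij (Prod.ext h1 h2)
    · simp
  · intro s
    rw [Fintype.sum_unique, ← trace_prod_of_row i₀]
    · have h1 : (List.ofFn fun l => Matrix.single (s l).1 (s l).2 (e (c (s l).1))).prod =
          e.mapMatrix (List.ofFn fun l => Matrix.single (s l).1 (s l).2 (c (s l).1)).prod := by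
        rw [map_list_prod, List.map_ofFn]
        congr 2
        funext l
        exact (Matrix.map_single _ _ _ e).symm
      rw [h1]
      change e (Matrix.trace _) = _
      rw [Matrix.trace, map_sum]
      rfl
    · intro l i j hi
      rw [Matrix.single_apply]
      split_ifs with h
      · rw [hc, if_neg]; rw [h.1]; exact hi
      · rfl

end Blend

/-! ## Invariance under conjugation -/

section Conjugation

open Polynomial

variable {k : Type uk} [Field k] [CharZero k]

variable (k) in
/-- The linear functional `p ↦ ∫₀¹ p`. -/
def unitIntegral : k[X] →ₗ[k] k :=
  Polynomial.lsum fun n => ((n : k) + 1)⁻¹ • LinearMap.id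

/-- The fundamental theorem of calculus for polynomials; characteristic zero makes `n + 1`
invertible. -/
theorem unitIntegral_derivative (p : k[X]) :
    unitIntegral k (derivative p) = p.eval 1 - p.eval 0 := by
  induction p using Polynomial.induction_on' with
  | add p q hp hq => simp only [map_add, hp, hq, eval_add]; ring
  | monomial n a =>
    rw [derivative_monomial, unitIntegral, Polynomial.lsum_apply]
    rw [Polynomial.sum_monomial_index _ _ (by simp)]
    rcases n with _ | n
    · simp
    · have : (n : k) + 1 ≠ 0 := Nat.cast_add_one_ne_zero n
      simp
      field_simp

variable {H : Type uH} {D : Type uD} {C : Type uC} (M : Type uM) [Ring H]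
  [HopfAlgebra k H] [Category.{vD} D] [Preadditive D] [Linear k D] [HCategory k H D]
  [Category.{vC} C] [Preadditive C] [Linear k C] [HCategory k H C]
  [AddCommGroup M] [Module k M] [Module Hᵐᵒᵖ M] [IsScalarTower k Hᵐᵒᵖ M]
  [SAYDModule k H M] [BijectiveAntipode k H]

/-- A cyclic cocycle changes by a coboundary when a semifunctor is conjugated by an invariant
family of automorphisms. -/
theorem exists_coboundary_conj (α : Semifunctor k H D C) (u : ∀ Y : C, Aut Y)
    (hu : ∀ Y, IsInvariant k H (u Y).hom) {n : ℕ} {φ : Cochain k C M n}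
    (hφ : φ ∈ Cocycles k H C M n) :
    ∃ ψ ∈ Coboundaries k H D M n, ∀ (m : M) (X : Fin (n + 1) → D)
      (f : ∀ l : Fin (n + 1), X (l + 1) ⟶ X l),
      ψ (m ⊗ₜ CN.gen k X f) =
        φ (m ⊗ₜ CN.gen k (fun l => α.obj (X l))
          (fun l => (u _).inv ≫ α.map (f l) ≫ (u _).hom)) -
        φ (m ⊗ₜ CN.gen k (fun l => α.obj (X l)) (fun l => α.map (f l))) := by
  let U : Fin 2 → ∀ Y : C, Y ⟶ Y := ![fun Y => 𝟙 Y, fun Y => (u Y).hom]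
  let V : Fin 2 → ∀ Y : C, Y ⟶ Y := ![fun Y => 𝟙 Y, fun Y => (u Y).inv]
  have hUV : ∀ j Y, U j Y ≫ V j Y = 𝟙 Y := by
    intro j Y
    fin_cases j
    · exact Category.id_comp _
    · exact (u Y).hom_inv_id
  have hU : ∀ j Y, IsInvariant k H (U j Y) := by
    intro j Y
    fin_cases j
    · exact isInvariant_id Y
    · exact hu Y
  have hV : ∀ j Y, IsInvariant k H (V j Y) := by
    intro j Y
    fin_cases j
    · exact isInvariant_id Y
    · exact IsInvariant.inv (hu Y)
  -- The sum `1` makes the blend multiplicative. The values at `0` and `1` are the indicators of the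
  -- two indices, so the path runs from `α` to its conjugate.
  let c : Fin 2 → k[X] := ![1 - X, X]
  have hc : ∑ i, c i = 1 := by simp [c]
  let σ : Fin 2 → k[X] := fun i => derivative (c i)
  have hσ : ∑ i, σ i = 0 := by simp [σ, c]
  let A := Matrix (Fin 2) (Fin 2) k[X]
  let γ : Semifunctor k H D (TensorCat k C A) := α.blend U V hUV hU hV c hc
  -- By `blend_comp`, `∑ σ = 0` gives `γ(f) ∘ x = 0`, and `∑ c = 1` gives `x ∘ γ(f) = γ(f)'`. The
  -- derivative of `γ` is thus the commutator with `x`.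
  let x : ∀ Y : TensorCat k C A, Y ⟶ Y := fun Y => blend U V σ Y.base Y.base (𝟙 Y.base)
  have hx : ∀ (h : H) (Y : TensorCat k C A), h • x Y = Coalgebra.counit (R := k) h • x Y := by
    intro h Y
    have : h • x Y = blend U V σ Y.base Y.base (h • 𝟙 Y.base) := blend_hsmul U V hU hV σ h _
    rw [this, HCategory.smul_id (k := k), map_smul]
  let δ : A →ₗ[k] A := (Polynomial.derivative (R := k)).mapMatrix
  have hpre : ∀ {X Y : D} (f : X ⟶ Y), preComp k x _ _ (γ.map f) = 0 := by
    intro X Y f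
    change blend U V σ _ _ (𝟙 (α.obj X)) ≫ blend U V c _ _ (α.map f) = 0
    rw [blend_comp U V hUV, hσ, zero_smul, blend_zero]
  have hpost : ∀ {X Y : D} (f : X ⟶ Y),
      postComp k x _ _ (γ.map f) = mapCoeff δ _ _ (γ.map f) := by
    intro X Y f
    change blend U V c _ _ (α.map f) ≫ blend U V σ _ _ (𝟙 (α.obj Y)) =
      mapCoeff δ _ _ (blend U V c _ _ (α.map f))
    rw [blend_comp U V hUV, hc, one_smul, Category.comp_id, mapCoeff_blend]
  let θ : A →ₗ[k] k := unitIntegral k ∘ₗ Matrix.traceLinearMap (Fin 2) k k[X]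
  have hθ : ∀ a b, θ (a * b) = θ (b * a) := fun a b =>
    congrArg (unitIntegral k) (Matrix.trace_mul_comm a b)
  let e : k → A →ₗ[k] k := fun t =>
    (Polynomial.aeval t).toLinearMap ∘ₗ Matrix.traceLinearMap (Fin 2) k k[X]
  -- Differentiation commutes with the matrix trace, so integrating a derivative gives the
  -- difference of the endpoint traces.
  have hθδ : θ ∘ₗ δ = e 1 - e 0 := by
    refine LinearMap.ext fun a => ?_
    have : (δ a).trace = derivative a.trace := by
      simp only [Matrix.trace, map_sum]; rfl
    change unitIntegral k (δ a).trace = aeval 1 a.trace - aeval 0 a.trace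
    rw [this, unitIntegral_derivative]
    simp [Polynomial.aeval_def, Polynomial.eval₂_eq_eval_map]
  have hΦ := (traceNerve (H := H) (D := C) θ hθ).pull_mem_cocycles hφ
  have hcob := commutator_mem_coboundaries M x hx hΦ
  -- The commutator sum is precomposition minus postcomposition and the former vanishes on `γ`,
  -- hence the sign.
  refine ⟨_, Submodule.neg_mem _ (γ.nerve.pull_mem_coboundaries hcob), fun m X f => ?_⟩
  have h0 : ∀ l, CN.slot k (preComp k x) l (γ.nerve.app n (CN.gen k X f)) = 0 := by
    intro l
    change CN.slot k (preComp k x) l (γ.nerveApp n (CN.gen k X f)) = 0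
    rw [γ.nerveApp_gen]
    exact CN.slot_eq_zero _ l _ _ (hpre (f l))
  have h1 : ∀ l, CN.slot k (postComp k x) l (γ.nerve.app n (CN.gen k X f)) =
      CN.slot k (mapCoeff δ) l (γ.nerveApp n (CN.gen k X f)) := by
    intro l
    change CN.slot k (postComp k x) l (γ.nerveApp n (CN.gen k X f)) = _
    rw [γ.nerveApp_gen]
    exact CN.slot_congr _ _ l _ _ (hpost (f l))
  have h2 : ∑ l, CN.trace k C θ n (CN.slot k (mapCoeff δ) l (γ.nerveApp n (CN.gen k X f))) =
      CN.gen k (fun l => α.obj (X l)) (fun l => (u _).inv ≫ α.map (f l) ≫ (u _).hom) -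
        CN.gen k (fun l => α.obj (X l)) (fun l => α.map (f l)) := by
    rw [CN.sum_trace_slot_mapCoeff θ δ derivative_mapMatrix_mul, hθδ, CN.trace_sub,
      γ.nerveApp_gen]
    congr 1
    · exact CN.trace_gen_blend U V (Polynomial.aeval 1) 1 c
        (by intro i; fin_cases i <;> simp [c]) (fun l => α.obj (X l)) (fun l => α.map (f l))
    · refine (CN.trace_gen_blend U V (Polynomial.aeval 0) 0 c
        (by intro i; fin_cases i <;> simp [c]) (fun l => α.obj (X l))
        (fun l => α.map (f l))).trans ?_
      congr 1
      funext l
      change 𝟙 _ ≫ α.map (f l) ≫ 𝟙 _ = _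
      rw [Category.comp_id, Category.id_comp]
  rw [LinearMap.neg_apply, NerveMap.pull_apply, LinearMap.lTensor_tmul, LinearMap.sum_apply]
  simp only [LinearMap.sub_apply, LinearMap.comp_apply, LinearMap.lTensor_tmul, h0, h1,
    TensorProduct.tmul_zero, map_zero, zero_sub, Finset.sum_neg_distrib, neg_neg,
    NerveMap.pull_apply]
  rw [← map_sub, ← TensorProduct.tmul_sub, ← h2, TensorProduct.tmul_sum, map_sum]
  rfl

end Conjugation

/-! ## The diagonal semifunctor -/

section Diagonal

variable {k : Type uk} {H : Type uH} {D : Type uD} [Field k] [Ring H] [HopfAlgebra k H]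
  [Category.{vD} D] [Preadditive D] [Linear k D]

/-- Products of distinct diagonal matrix units vanish, so there are no mixed terms. -/
theorem CN.trace_gen_diagonal {n : ℕ} {J : Type} [Fintype J] [DecidableEq J]
    (X : Fin (n + 1) → D) (v : ∀ l : Fin (n + 1), J → (X (l + 1) ⟶ X l)) :
    CN.trace k D (Matrix.traceLinearMap J k k) n
      (CN.gen k (fun l => (⟨X l⟩ : TensorCat k D (Matrix J J k)))
        (fun l => ∑ r, pure (v l r) (Matrix.single r r 1))) = ∑ r, CN.gen k X (fun l => v l r) := by
  rw [CN.trace_gen_sum (S := J) _ (fun r => Matrix.single r r 1) (fun c => Pi.single c 1) ?_ X v]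
  · refine Finset.sum_congr rfl fun c _ => ?_
    congr 1
    funext l
    rw [Finset.sum_eq_single c (fun r _ hr => by rw [Pi.single_eq_of_ne hr, zero_smul])
      (fun h => absurd (Finset.mem_univ _) h), Pi.single_eq_same, one_smul]
  · intro s
    have h := trace_prod_diagonal (fun l => (Pi.single (s l) 1 : J → k))
    simp only [Matrix.diagonal_single] at h
    refine h.trans (Finset.sum_congr rfl fun c _ => Finset.prod_congr rfl fun l _ => ?_)
    rw [Pi.single_apply, Pi.single_apply]
    exact if_congr eq_comm rfl rfl

theorem CN.gen_zero {n : ℕ} (X : Fin (n + 1) → D) : CN.gen k X (fun _ => 0) = 0 := by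
  rw [CN.gen, MultilinearMap.map_coord_zero _ 0 rfl, map_zero]

variable [HCategory k H D]

namespace HSemifunctor

variable (υ : HSemifunctor k H D D) (hυ : ∀ X, υ.obj X = X)

/-- `mapFix` as a linear map. -/
def mapFixL (X Y : D) : (X ⟶ Y) →ₗ[k] (X ⟶ Y) := castHom k (hυ X) (hυ Y) ∘ₗ υ.map

theorem mapFix_comp {X Y Z : D} (f : X ⟶ Y) (g : Y ⟶ Z) :
    υ.mapFix hυ (f ≫ g) = υ.mapFix hυ f ≫ υ.mapFix hυ g := by
  simp [mapFix, υ.map_comp]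

theorem mapFix_hsmul {X Y : D} (h : H) (f : X ⟶ Y) :
    υ.mapFix hυ (h • f) = h • υ.mapFix hυ f := by
  change castHom k (hυ X) (hυ Y) (υ.map (h • f)) = h • castHom k (hυ X) (hυ Y) (υ.map f)
  rw [υ.map_hsmul, hsmul_castHom]

/-- The map `f ↦ f ⊗ E₁₁ + υ(f) ⊗ E₂₂`. -/
def diagonalHom (X Y : D) :
    (X ⟶ Y) →ₗ[k] ((⟨X⟩ : TensorCat k D (Matrix (Fin 2) (Fin 2) k)) ⟶ ⟨Y⟩) :=
  (pureL (k := k) (⟨X⟩ : TensorCat k D (Matrix (Fin 2) (Fin 2) k)) ⟨Y⟩).flip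
      (Matrix.single 0 0 1) +
    (pureL (k := k) (⟨X⟩ : TensorCat k D (Matrix (Fin 2) (Fin 2) k)) ⟨Y⟩).flip
      (Matrix.single 1 1 1) ∘ₗ υ.mapFixL hυ X Y

theorem diagonalHom_apply {X Y : D} (f : X ⟶ Y) : υ.diagonalHom hυ X Y f =
    (pure f (Matrix.single 0 0 1) : (⟨X⟩ : TensorCat k D (Matrix (Fin 2) (Fin 2) k)) ⟶ ⟨Y⟩) +
      pure (υ.mapFix hυ f) (Matrix.single 1 1 1) := rfl

/-- The semifunctor `f ↦ f ⊗ E₁₁ + υ(f) ⊗ E₂₂`. -/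
def diagonal : Semifunctor k H D (TensorCat k D (Matrix (Fin 2) (Fin 2) k)) where
  obj X := ⟨X⟩
  map {X Y} := υ.diagonalHom hυ X Y
  map_comp {X Y Z} f g := by
    simp only [diagonalHom_apply, mapFix_comp, Preadditive.add_comp, Preadditive.comp_add,
      pure_comp, Matrix.single_mul_single_same, mul_one]
    rw [Matrix.single_mul_single_of_ne _ _ _ _ (by decide),
      Matrix.single_mul_single_of_ne _ _ _ _ (by decide)]
    have h0 : ∀ w : X ⟶ Z,
        (pure w 0 : (⟨X⟩ : TensorCat k D (Matrix (Fin 2) (Fin 2) k)) ⟶ ⟨Z⟩) = 0 :=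
      fun w => TensorProduct.tmul_zero _ _
    rw [h0, h0, add_zero, zero_add]
  map_hsmul {X Y} h f := by
    simp only [diagonalHom_apply, mapFix_hsmul, smul_add, hsmul_pure]

end HSemifunctor

/-- If `f ⊗ E₁₁ + υ(f) ⊗ E₂₂` is conjugate to `υ(f) ⊗ E₂₂` by an invariant family of
automorphisms, then every cyclic cocycle is a coboundary. -/
theorem cocycles_le_coboundaries [CharZero k] [BijectiveAntipode k H] (M : Type uM)
    [AddCommGroup M] [Module k M] [Module Hᵐᵒᵖ M] [IsScalarTower k Hᵐᵒᵖ M] [SAYDModule k H M]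
    (υ : HSemifunctor k H D D) (hυ : ∀ X, υ.obj X = X)
    (η : ∀ X : TensorCat k D (Matrix (Fin 2) (Fin 2) k), Aut X)
    (hη : η ∈ invariantAut k H (TensorCat k D (Matrix (Fin 2) (Fin 2) k)))
    (hΦ : ∀ (X Y : D) (f : X ⟶ Y), (innerAut η).map (υ.diagonalHom hυ X Y f) =
      TensorCat.tmul (υ.mapFix hυ f) (Matrix.single 1 1 (1 : k))) (n : ℕ) :
    Cocycles k H D M n ≤ Coboundaries k H D M n := by
  intro φ hφ
  let T : NerveMap k H (TensorCat k D (Matrix (Fin 2) (Fin 2) k)) D :=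
    traceNerve (Matrix.traceLinearMap (Fin 2) k k) Matrix.trace_mul_comm
  obtain ⟨ψ, hψ, h⟩ := exists_coboundary_conj M (υ.diagonal hυ) η (fun Y a => hη a Y)
    (T.pull_mem_cocycles hφ)
  -- On generators `ψ` is `υ*φ - (φ + υ*φ)`.
  suffices e : φ = -ψ by rw [e]; exact Submodule.neg_mem _ hψ
  refine TensorProduct.ext' fun m c => ?_
  suffices e : φ ∘ₗ TensorProduct.mk k M (CN k D n) m =
      (-ψ) ∘ₗ TensorProduct.mk k M (CN k D n) m from LinearMap.congr_fun e c
  refine CN.hom_ext fun X f => ?_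
  change φ (m ⊗ₜ CN.gen k X f) = -ψ (m ⊗ₜ CN.gen k X f)
  have h1 : T.app n (CN.gen k (fun l => (υ.diagonal hυ).obj (X l))
      (fun l => (υ.diagonal hυ).map (f l))) =
      CN.gen k X f + CN.gen k X (fun l => υ.mapFix hυ (f l)) := by
    have := CN.trace_gen_diagonal (k := k) (J := Fin 2) X
      (fun l => ![f l, υ.mapFix hυ (f l)])
    simp only [Fin.sum_univ_two] at this
    exact this
  have h2 : T.app n (CN.gen k (fun l => (υ.diagonal hυ).obj (X l))
      (fun l => (η _).inv ≫ (υ.diagonal hυ).map (f l) ≫ (η _).hom)) =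
      CN.gen k X (fun l => υ.mapFix hυ (f l)) := by
    -- The conjugated family is diagonal with zero first entry, and the generator of the zero family
    -- vanishes.
    have := CN.trace_gen_diagonal (k := k) (J := Fin 2) X
      (fun l => ![0, υ.mapFix hυ (f l)])
    simp only [Fin.sum_univ_two, Matrix.cons_val_zero, Matrix.cons_val_one, CN.gen_zero,
      zero_add] at this
    rw [← this]
    refine congrArg (T.app n) (congrArg (CN.gen k _) (funext fun l => (hΦ _ _ (f l)).trans ?_))
    exact ((congrArg (· + _) (TensorProduct.zero_tmul _ _)).trans (zero_add _)).symm
  rw [h, NerveMap.pull_apply, NerveMap.pull_apply, LinearMap.lTensor_tmul,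
    LinearMap.lTensor_tmul, h1, h2, TensorProduct.tmul_add, map_add]
  abel

end Diagonal

end HopfCyclic

end

theorem proposition5p5
    {k : Type*} {H : Type*} {D : Type*} {M : Type*}
    [Field k] [CharZero k] [Ring H] [HopfAlgebra k H] [HopfCyclic.BijectiveAntipode k H]
    [Category D] [Preadditive D] [Linear k D] [HopfCyclic.HCategory k H D]
    [AddCommGroup M] [Module k M] [Module Hᵐᵒᵖ M] [IsScalarTower k Hᵐᵒᵖ M]
    [HopfCyclic.SAYDModule k H M]
    (υ : HopfCyclic.HSemifunctor k H D D) (hυ : ∀ X : D, υ.obj X = X)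
    (η : ∀ X : HopfCyclic.TensorCat k D (Matrix (Fin 2) (Fin 2) k), Aut X)
    (hη : η ∈ HopfCyclic.invariantAut k H
      (HopfCyclic.TensorCat k D (Matrix (Fin 2) (Fin 2) k)))
    (hΦ : ∀ (X Y : D) (f : X ⟶ Y),
      (HopfCyclic.innerAut η).map
          (HopfCyclic.TensorCat.tmul f (Matrix.single 0 0 (1 : k)) +
            HopfCyclic.TensorCat.tmul (υ.mapFix hυ f) (Matrix.single 1 1 (1 : k))) =
        HopfCyclic.TensorCat.tmul (υ.mapFix hυ f) (Matrix.single 1 1 (1 : k)))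
    (n : ℕ) :
    Subsingleton (HopfCyclic.HC k H D M n) := by
  refine Submodule.Quotient.subsingleton_iff.mpr (Submodule.comap_subtype_eq_top.mpr ?_)
  exact HopfCyclic.cocycles_le_coboundaries M υ hυ η hη hΦ n
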